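/- Let $X$ and $Y$ be real Banach spaces and let $L(X,Y)$ be the Banach space of bounded linear operators from $X$ to $Y$. Suppose that $L(X,Y)$ has the weak Radon–Nikodým property: for every finite measure space $(\Omega,\Sigma,\mu)$ and every countably additive $m:\Sigma\to L(X,Y)$ of bounded variation that vanishes on $\mu$-null sets, there is a Pettis integrable $f:\Omega\to L(X,Y)$ with $m(A)=\text{Pettis-}\int_A f\,d\mu$ for all $A\in\Sigma$. Let $H$ be a compact Hausdorff space with Borel $\sigma$-algebra $\beta(H)$, and let $T:C(H,X)\to Y$ be a bounded linear operator with representing measure $m:\beta(H)\to L(X,Y^{**})$, that is, $m$ is finitely additive, has finite semivariation, is weakly regular (the scalar set function $A\mapsto\langle y^*,m(A)x\rangle$ is regular for all $x\in X$, $y^*\in Y^*$), and $T(g)=\int g\,dm$ in $Y^{**}$ for all $g\in C(H,X)$. Suppose that $m$ has bounded variation, $|m|(H)<\infty$. Then $m$ takes its values in $L(X,Y)$ (where $Y\subseteq Y^{**}$ canonically), $m:\beta(H)\to L(X,Y)$ is countably additive, its variation $\mu=|m|$ is a finite measure, and $m$ has a Pettis integrable Radon–Nikodým derivative $f:H\to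 L(X,Y)$ with respect to $\mu$. Moreover, for each such $f$ the partition averages $$f_\pi=\sum_{A\in\pi}\frac{m(A)}{\mu(A)}\chi_A\qquad\left(\tfrac00=0\right),$$ where $\pi$ runs over the finite partitions of $H$ into Borel sets, directed by refinement, converge to $f$ in Pettis norm: $$\lim_\pi\ \sup\left\{\int_H|\varphi(f_\pi-f)|\,d\mu\ :\ \varphi\in L(X,Y)^*,\ \|\varphi\|\le 1\right\}=0.$$ -/

import Mathlib

open MeasureTheory Filter Topology
open scoped ENNReal

universe u v w

noncomputable section

/-- The space `L(X, Y)` of bounded linear operators between normed spaces (norm structures on both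
sides), as a normed space with the operator norm. -/
abbrev OpSpace (X Y : Type*) [NormedAddCommGroup X] [NormedSpace ℝ X]
    [NormedAddCommGroup Y] [NormedSpace ℝ Y] : Type _ := X →L[ℝ] Y

/-- Countably additive measures with values in a normed space. -/
abbrev NormedVectorMeasure (Ω E : Type*) [MeasurableSpace Ω] [NormedAddCommGroup E] : Type _ :=
  VectorMeasure Ω E

/-- Finite partitions of `Ω` into nonempty measurable sets. In the order of `Finpartition`,
`π ≤ ρ` means that `π` refines `ρ`, so the net of partitions directed by refinement is the
filter `atBot`. -/
abbrev MeasPartition (Ω : Type*) [MeasurableSpace Ω] : Type _ :=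
  Finpartition (⟨Set.univ, MeasurableSet.univ⟩ : Subtype (MeasurableSet : Set Ω → Prop))

section Pettis

variable {Ω E : Type*} [MeasurableSpace Ω] [NormedAddCommGroup E] [NormedSpace ℝ E]

/-- `v` is the Pettis integral of `f` over `A`. -/
def HasPettisIntegralOn (f : Ω → E) (μ : Measure Ω) (A : Set Ω) (v : E) : Prop :=
  ∀ φ : StrongDual ℝ E, φ v = ∫ ω in A, φ (f ω) ∂μ

/-- `f` is Pettis integrable: it is scalarly integrable, and it has a Pettis integral in `E` over
each measurable set. (`Integrable` refers to measurability with respect to the completion.) -/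
def PettisIntegrable (f : Ω → E) (μ : Measure Ω) : Prop :=
  (∀ φ : StrongDual ℝ E, Integrable (fun ω => φ (f ω)) μ) ∧
    ∀ A, MeasurableSet A → ∃ v : E, HasPettisIntegralOn f μ A v

/-- `f` is a Pettis integrable Radon-Nikodym derivative of `m` with respect to `μ`. -/
def IsPettisDensity (m : NormedVectorMeasure Ω E) (μ : Measure Ω) (f : Ω → E) : Prop :=
  PettisIntegrable f μ ∧ ∀ A, MeasurableSet A → HasPettisIntegralOn f μ A (m A)

/-- The Pettis norm `sup {∫ |φ ∘ g| dμ : ‖φ‖ ≤ 1}`. -/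
def pettisNorm (g : Ω → E) (μ : Measure Ω) : ℝ≥0∞ :=
  ⨆ (φ : StrongDual ℝ E) (_ : ‖φ‖ ≤ 1), ∫⁻ ω, ‖φ (g ω)‖ₑ ∂μ

/-- The partition average `f_π = ∑_{A ∈ π} (m(A) / μ(A)) χ_A`, with the convention `0 / 0 = 0`. -/
def partitionAverage (m : NormedVectorMeasure Ω E) (μ : Measure Ω) (π : MeasPartition Ω) : Ω → E :=
  fun ω => ∑ A ∈ π.parts, (A : Set Ω).indicator (fun _ => (μ.real (A : Set Ω))⁻¹ • m A) ω

end Pettis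

/-- The weak Radon-Nikodym property: each countably additive `E`-valued measure of bounded
variation that is absolutely continuous with respect to a finite measure `μ` has a Pettis
integrable derivative with respect to `μ`. Since `Integrable` does not distinguish `μ` from its
completion, it makes no difference whether `μ` ranges over the complete finite measures only. -/
def WeakRadonNikodymProperty (E : Type v) [NormedAddCommGroup E] [NormedSpace ℝ E] : Prop :=
  ∀ (Ω : Type u) [MeasurableSpace Ω] (μ : Measure Ω) [IsFiniteMeasure μ] (m : NormedVectorMeasure Ω E),
    m.variation Set.univ ≠ ∞ →
    (∀ A, MeasurableSet A → μ A = 0 → m A = 0) →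
    ∃ f : Ω → E, IsPettisDensity m μ f

section Representation

variable {H X Z : Type*} [MeasurableSpace H]
  [NormedAddCommGroup X] [NormedSpace ℝ X] [NormedAddCommGroup Z] [NormedSpace ℝ Z]

/-- The variation `|m|(A) = sup ∑_{B ∈ P} ‖m B‖`, over the finite measurable partitions `P` of the
measurable set `A`, of a set function `m` (only its values on measurable sets matter). -/
def setVariation (m : Set H → Z) (A : Set H) : ℝ≥0∞ :=
  preVariationFun (fun B => ‖m B‖ₑ) A

/-- The semivariation on the whole space of an operator-valued set function:
`sup ‖∑ m(A_i) x_i‖` over finite measurable partitions `(A_i)` and `x_i` in the unit ball,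
that is, `sup ‖∫ s dm‖` over simple functions `s` bounded by `1`. -/
def totalSemivariation (m : Set H → OpSpace X Z) : ℝ≥0∞ :=
  ⨆ (s : SimpleFunc H X) (_ : ∀ h, ‖s h‖ ≤ 1), ‖s.setToSimpleFunc m‖ₑ

/-- `z = ∫ f dm` for a set function `m` of finite semivariation and a uniform limit `f` of simple
functions: the integrals `∑ m(A_i) x_i` of simple functions tending uniformly to `f` tend to `z`. -/
def HasUniformIntegral (m : Set H → OpSpace X Z) (f : H → X) (z : Z) : Prop :=
  ∀ s : ℕ → SimpleFunc H X, TendstoUniformly (fun n h => s n h) f atTop →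
    Tendsto (fun n => (s n).setToSimpleFunc m) atTop (𝓝 z)

/-- Regularity of a scalar additive set function on the Borel sets. -/
def IsRegularSetFun [TopologicalSpace H] (l : Set H → ℝ) : Prop :=
  ∀ A, MeasurableSet A → ∀ ε > 0, ∃ K U, IsCompact K ∧ IsOpen U ∧ K ⊆ A ∧ A ⊆ U ∧
    ∀ B, MeasurableSet B → B ⊆ U \ K → |l B| ≤ ε

end Representation

/-- The correspondence `m ↔ T` for an operator `T : C(H, X) → Y`: `m` is a finitely additive,
weakly regular set function on the Borel sets with values in `L(X, Y**)` and with finite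
semivariation, and `T f = ∫ f dm` for all `f`. -/
structure Represents {H X Y : Type*} [TopologicalSpace H] [CompactSpace H] [MeasurableSpace H]
    [NormedAddCommGroup X] [NormedSpace ℝ X] [NormedAddCommGroup Y] [NormedSpace ℝ Y]
    (m : Set H → OpSpace X (StrongDual ℝ (StrongDual ℝ Y))) (T : C(H, X) →L[ℝ] Y) : Prop where
  additive : ∀ A B, MeasurableSet A → MeasurableSet B → Disjoint A B → m (A ∪ B) = m A + m B
  semivariation_ne_top : totalSemivariation m ≠ ∞
  weaklyRegular : ∀ (x : X) (y' : StrongDual ℝ Y), IsRegularSetFun (fun A => m A x y')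
  integral_eq : ∀ f : C(H, X),
    HasUniformIntegral m f (NormedSpace.inclusionInDoubleDual ℝ Y (T f))

end

/-! Weak regularity makes each scalar set function A ↦ `m A x y'` continuous at the empty set
(Alexandroff, `IsRegularSetFun.tendsto_zero`). Operator norms are suprema of such scalars, so ‖m(·)‖
is countably subadditive. The variation μ is therefore a finite measure dominating m, which makes m
countably additive, and μ inherits inner regularity. An indicator is then close in L¹(μ) to a
continuous g, so T(g x) is close to m(A)x, which lies in Y because Y is closed in Y**. The weak
Radon–Nikodým property supplies f.

For the convergence, φ∘f_π is the conditional expectation of φ∘f. Averaging contracts L¹ and fixes a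
simple function once π is fine enough, so averages converge uniformly on totally bounded sets. The
crux is that {φ∘f : ‖φ‖ ≤ 1} is totally bounded in L¹ (`exists_finset_dual_net`). Otherwise it
contains a separated sequence u_n = φ_n∘f. Along every ultrafilter φ_n has a weak* limit ψ, so u_n
tends pointwise to the measurable ψ∘f, against Fremlin's alternative
(`exists_ultrafilter_forall_not_tendsto`).

To prove the alternative, subtract a weak limit g: h_n = u_n - g tends weakly to 0 and |h_n| does
not. So on some nonnull E both {h_n ≥ δ} and {h_n ≤ -δ} fill a fixed proportion of any given
measurable set for most n. A subsequence does this for all sets generated by its earlier terms. By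
`exists_finite_hitting` and Lusin, each nonnull measurable part of E has finitely many points such
that every late {h_n ≥ δ} contains one of them, and likewise for {h_n ≤ -δ}. So a measurable limit
of h_n can be neither positive nor nonpositive on a nonnull part of E. -/

/-! ### Finite algebras generated by initial segments of a sequence -/

section Saturated

variable {H α : Type*}

/-- `B` is a union of atoms of the algebra generated by the first `n` of the functions `p j`. -/
def SaturatedUpTo (p : ℕ → H → α) (n : ℕ) (B : Set H) : Prop :=
  ∀ z z', (∀ j < n, p j z = p j z') → z ∈ B → z' ∈ B

lemma SaturatedUpTo.measurableSet [MeasurableSpace H] [Finite α] [MeasurableSpace α]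
    [DiscreteMeasurableSpace α] {p : ℕ → H → α} (hp : ∀ n, Measurable (p n)) {n : ℕ} {B : Set H}
    (hB : SaturatedUpTo p n B) : MeasurableSet B := by
  let r : H → (Fin n → α) := fun z j => p j z
  have hr : Measurable r := measurable_pi_lambda _ fun j => hp j
  have : B = r ⁻¹' (r '' B) := by
    ext z
    refine ⟨fun h => ⟨z, h, rfl⟩, ?_⟩
    rintro ⟨z', hz', h⟩
    exact hB z' z (fun j hj => congrFun h ⟨j, hj⟩) hz'
  rw [this]
  exact hr (Set.toFinite _).measurableSet

lemma SaturatedUpTo.mono {p : ℕ → H → α} {n n' : ℕ} (h : n ≤ n') {B : Set H}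
    (hB : SaturatedUpTo p n B) : SaturatedUpTo p n' B :=
  fun z z' hz => hB z z' fun j hj => hz j (hj.trans_le h)

lemma SaturatedUpTo.inter {p : ℕ → H → α} {n : ℕ} {B C : Set H}
    (hB : SaturatedUpTo p n B) (hC : SaturatedUpTo p n C) : SaturatedUpTo p n (B ∩ C) :=
  fun z z' hz h => ⟨hB z z' hz h.1, hC z z' hz h.2⟩

lemma SaturatedUpTo.compl {p : ℕ → H → α} {n : ℕ} {B : Set H}
    (hB : SaturatedUpTo p n B) : SaturatedUpTo p n Bᶜ :=
  fun z z' hz h h' => h (hB z' z (fun j hj => (hz j hj).symm) h')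

lemma saturatedUpTo_preimage (p : ℕ → H → α) (n : ℕ) (s : Set α) :
    SaturatedUpTo p (n + 1) (p n ⁻¹' s) := fun z z' hz h => by
  have := hz n (Nat.lt_succ_self n)
  simpa [Set.mem_preimage, this] using h

/-- The smallest `SaturatedUpTo p n` set that contains `D`. -/
def saturation (p : ℕ → H → α) (D : Set H) (n : ℕ) : Set H :=
  {z | ∃ z' ∈ D, ∀ j < n, p j z' = p j z}


lemma saturatedUpTo_saturation (p : ℕ → H → α) (D : Set H) (n : ℕ) :
    SaturatedUpTo p n (saturation p D n) := by
  rintro z z' hz ⟨y, hy, h⟩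
  exact ⟨y, hy, fun j hj => (h j hj).trans (hz j hj)⟩

lemma saturation_antitone (p : ℕ → H → α) (D : Set H) : Antitone (saturation p D) := by
  rintro n n' h z ⟨y, hy, hyz⟩
  exact ⟨y, hy, fun j hj => hyz j (hj.trans_le h)⟩

end Saturated

/-! ### Splitting sets without raising the total defect -/

section Defect

variable {H : Type*} [MeasurableSpace H] {μ : Measure H}

/-- The proportion of `B` that lies outside `D`. -/
noncomputable def defect (μ : Measure H) (D B : Set H) : ℝ := μ.real (B \ D) / μ.real B

/-- The defect of `B` is the mean of the defects of its two pieces, weighted by their measures. If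
`B ∩ Q` lies above the mean, `B \ Q` lies below it, by at least the weight `ε` times the gap. -/
lemma defect_split [IsFiniteMeasure μ] {D B Q : Set H}
    (hQ : MeasurableSet Q) (hμB : 0 < μ.real B) {ε : ℝ} (hε : 0 < ε)
    (h : ε * μ.real B ≤ μ.real (B ∩ Q)) :
    defect μ D (B ∩ Q) ≤ defect μ D B ∨
      (0 < μ.real (B \ Q) ∧ defect μ D (B \ Q) ≤ defect μ D B ∧
        defect μ D (B \ Q) ≤ defect μ D (B ∩ Q) ∧
        defect μ D (B \ Q) + ε * (defect μ D (B ∩ Q) - defect μ D (B \ Q)) ≤ defect μ D B) := by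
  have e1 : μ.real (B ∩ Q) + μ.real (B \ Q) = μ.real B := measureReal_inter_add_sdiff hQ
  have e2 : μ.real ((B ∩ Q) \ D) + μ.real ((B \ Q) \ D) = μ.real (B \ D) := by
    rw [← measureReal_inter_add_sdiff (s := B \ D) hQ]
    congr 2 <;> grind
  have hpos : 0 < μ.real (B ∩ Q) := lt_of_lt_of_le (by positivity) h
  by_cases hb : defect μ D (B ∩ Q) ≤ defect μ D B
  · exact Or.inl hb
  right
  push Not at hb
  unfold defect at *
  have h0 : 0 ≤ μ.real ((B \ Q) \ D) := measureReal_nonneg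
  have h2 : 0 < μ.real (B \ Q) := by
    by_contra hcon
    have hz : μ.real (B \ Q) = 0 := le_antisymm (not_lt.1 hcon) measureReal_nonneg
    have : μ.real ((B \ Q) \ D) ≤ 0 := hz ▸ measureReal_mono Set.sdiff_subset
    have h3 : μ.real (B \ D) = μ.real ((B ∩ Q) \ D) := by linarith
    have h4 : μ.real B = μ.real (B ∩ Q) := by linarith
    rw [h3, h4] at hb
    exact lt_irrefl _ hb
  set x := μ.real (B ∩ Q)
  set y := μ.real (B \ Q)
  set t := μ.real B
  obtain ⟨b, hb'⟩ : ∃ b, b = μ.real ((B ∩ Q) \ D) / x := ⟨_, rfl⟩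
  obtain ⟨a, ha'⟩ : ∃ a, a = μ.real ((B \ Q) \ D) / y := ⟨_, rfl⟩
  obtain ⟨d, hd'⟩ : ∃ d, d = μ.real (B \ D) / t := ⟨_, rfl⟩
  rw [← hb', ← hd'] at hb
  rw [← hb', ← hd', ← ha']
  rw [eq_div_iff (by positivity)] at hb' ha' hd'
  have key : b * x + a * y = d * t := by rw [hb', ha', hd', e2]
  have hbd : 0 < (b - d) * x := mul_pos (by linarith) hpos
  have had : a ≤ d := by
    by_contra hcon
    push Not at hcon
    have : 0 < (a - d) * y := mul_pos (by linarith) h2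
    have : d * t = d * x + d * y := by rw [← e1]; ring
    nlinarith
  refine ⟨h2, had, by linarith, ?_⟩
  have h5 : (b - a) * (ε * t) ≤ (b - a) * x := mul_le_mul_of_nonneg_left h (by linarith)
  have h6 : (a + ε * (b - a)) * t ≤ d * t := by
    rw [← key]
    have : a * t = a * x + a * y := by rw [← e1]; ring
    nlinarith
  exact le_of_mul_le_mul_right h6 hμB

/-- If no `B i ∩ Q` comes for free, passing to `B i \ Q` everywhere saves `ε` times the gap of each
`i`. The index with the smallest gap `c` can then afford `B j ∩ Q`: it costs `c`, and the savings
are at least `k * ε * c ≥ c`. -/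
lemma exists_refinement [IsFiniteMeasure μ] {D Q : Set H} (hQ : MeasurableSet Q) {ε : ℝ}
    (hε : 0 < ε) {k : ℕ} (hk : 1 ≤ k * ε) (B : Fin k → Set H) (hB : ∀ i, 0 < μ.real (B i))
    (h : ∀ i, ε * μ.real (B i) ≤ μ.real (B i ∩ Q)) :
    ∃ B' : Fin k → Set H, (∀ i, B' i = B i ∩ Q ∨ B' i = B i \ Q) ∧ (∀ i, 0 < μ.real (B' i)) ∧
      (∑ i, defect μ D (B' i) ≤ ∑ i, defect μ D (B i)) ∧ ∃ i, B' i = B i ∩ Q := by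
  classical
  have hQpos i : 0 < μ.real (B i ∩ Q) := lt_of_lt_of_le (mul_pos hε (hB i)) (h i)
  by_cases hex : ∃ i, defect μ D (B i ∩ Q) ≤ defect μ D (B i)
  · obtain ⟨i₀, hi₀⟩ := hex
    refine ⟨fun i => if defect μ D (B i ∩ Q) ≤ defect μ D (B i) then B i ∩ Q else B i \ Q,
      fun i => ?_, fun i => ?_, Finset.sum_le_sum fun i _ => ?_, i₀, if_pos hi₀⟩ <;>
    dsimp only <;> split_ifs with hi
    · exact Or.inl rfl
    · exact Or.inr rfl
    · exact hQpos i
    · exact ((defect_split hQ (hB i) hε (h i)).resolve_left hi).1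
    · exact hi
    · exact ((defect_split hQ (hB i) hε (h i)).resolve_left hi).2.1
  · push Not at hex
    have hs i := (defect_split hQ (hB i) hε (h i)).resolve_left (not_le.2 (hex i))
    have : Nonempty (Fin k) := by
      rw [← Fin.pos_iff_nonempty]
      rcases Nat.eq_zero_or_pos k with rfl | h
      · norm_num at hk
      · exact h
    obtain ⟨j, hj⟩ := Finite.exists_min fun i => defect μ D (B i ∩ Q) - defect μ D (B i \ Q)
    set c := defect μ D (B j ∩ Q) - defect μ D (B j \ Q) with hc
    have hc0 : 0 ≤ c := sub_nonneg.2 (hs j).2.2.1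
    refine ⟨fun i => if i = j then B i ∩ Q else B i \ Q,
      fun i => ?_, fun i => ?_, ?_, j, if_pos rfl⟩
    · dsimp only; split_ifs <;> simp
    · dsimp only; split_ifs
      · exact hQpos i
      · exact (hs i).1
    · calc ∑ i, defect μ D (if i = j then B i ∩ Q else B i \ Q)
          = ∑ i, (defect μ D (B i \ Q) + if i = j then c else 0) := by
            refine Finset.sum_congr rfl fun i _ => ?_
            split_ifs with hij
            · subst hij; rw [hc]; ring
            · ring
        _ = ∑ i, defect μ D (B i \ Q) + c := by
            rw [Finset.sum_add_distrib]; simp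
        _ ≤ ∑ i, defect μ D (B i \ Q) + ∑ _i : Fin k, ε * c := by
            gcongr
            rw [Finset.sum_const, Finset.card_univ, Fintype.card_fin, nsmul_eq_mul, ← mul_assoc]
            exact le_mul_of_one_le_left hc0 hk
        _ = ∑ i, (defect μ D (B i \ Q) + ε * c) := by rw [Finset.sum_add_distrib]
        _ ≤ ∑ i, defect μ D (B i) := by
            refine Finset.sum_le_sum fun i _ => le_trans ?_ (hs i).2.2.2
            gcongr
            exact hj i

end Defect

/-! ### Finitely many points that hit every late level set -/

section Hitting

variable {H α : Type*} [MeasurableSpace H] {μ : Measure H} [IsFiniteMeasure μ]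
  [Finite α] [MeasurableSpace α] [DiscreteMeasurableSpace α]

/-- The saturations of `D` decrease to their intersection, so a late one has little mass outside it.
-/
lemma exists_saturatedUpTo_defect_lt {p : ℕ → H → α} (hp : ∀ n, Measurable (p n)) {D : Set H}
    (hD : 0 < μ D) {δ : ℝ} (hδ : 0 < δ) :
    ∃ n B, SaturatedUpTo p n B ∧ 0 < μ.real B ∧
      defect μ (⋂ n, saturation p D n) B < δ := by
  set D' := ⋂ n, saturation p D n with hD'
  have hmeas n : MeasurableSet (saturation p D n) := (saturatedUpTo_saturation p D n).measurableSet hp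
  have hsub : D ⊆ D' := fun z hz => Set.mem_iInter.2 fun n => ⟨z, hz, fun _ _ => rfl⟩
  have hpos : 0 < μ.real D' := by
    rw [measureReal_def, ENNReal.toReal_pos_iff]
    exact ⟨hD.trans_le (measure_mono hsub), measure_lt_top _ _⟩
  have hlim : Tendsto (fun n => μ (saturation p D n)) atTop (𝓝 (μ D')) :=
    tendsto_measure_iInter_atTop (fun n => (hmeas n).nullMeasurableSet)
      (saturation_antitone p D) ⟨0, measure_ne_top _ _⟩
  have hlim' : Tendsto (fun n => μ.real (saturation p D n)) atTop (𝓝 (μ.real D')) :=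
    (ENNReal.tendsto_toReal (measure_ne_top _ _)).comp hlim
  obtain ⟨n, hn⟩ := (hlim'.eventually (gt_mem_nhds
    (show μ.real D' < μ.real D' + δ * μ.real D' by nlinarith))).exists
  have hle : D' ⊆ saturation p D n := Set.iInter_subset _ n
  have hge : μ.real D' ≤ μ.real (saturation p D n) := measureReal_mono hle
  refine ⟨n, _, saturatedUpTo_saturation p D n, hpos.trans_le hge, ?_⟩
  rw [defect, div_lt_iff₀ (hpos.trans_le hge),
    measureReal_sdiff hle (MeasurableSet.iInter hmeas)]
  nlinarith

/-- If each set of the algebra generated by `p 0, …, p (n - 1)` meets `{p n = q}` in at least a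
fixed proportion, then for each compact set `D` of positive measure on which the `p n` are
continuous, there are finitely many points of `D` such that, for almost all `n`, at least one of
them is in `{p n = q}`. -/
theorem exists_finite_hitting [TopologicalSpace H] [TopologicalSpace α] [DiscreteTopology α]
    {p : ℕ → H → α} (hp : ∀ n, Measurable (p n)) {q : α} {ε : ℝ}
    (hε : 0 < ε)
    (hmix : ∀ n B, SaturatedUpTo p n B → ε * μ.real B ≤ μ.real (B ∩ p n ⁻¹' {q}))
    {D : Set H} (hDc : IsCompact D) (hcont : ∀ n, ContinuousOn (p n) D) (hD : 0 < μ D) :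
    ∃ (k : ℕ) (z : Fin k → H), (∀ i, z i ∈ D) ∧ ∃ n₀, ∀ n ≥ n₀, ∃ i, p n (z i) = q := by
  -- `k` sets are refined together, all starting as one set of defect below `1 / k`. The total
  -- defect starts below 1 and never grows.
  obtain ⟨k, hk⟩ := exists_nat_ge ε⁻¹
  have hk1 : 1 ≤ k * ε := by
    rw [inv_le_iff_one_le_mul₀ hε] at hk
    linarith
  have hk0 : (0 : ℝ) < k := lt_of_lt_of_le (inv_pos.2 hε) hk
  obtain ⟨n₀, B₀, hB₀, hB₀pos, hB₀def⟩ :=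
    exists_saturatedUpTo_defect_lt (μ := μ) hp hD (inv_pos.2 hk0)
  set D' := ⋂ n, saturation p D n with hD'
  have hD'm : MeasurableSet D' :=
    MeasurableSet.iInter fun n => (saturatedUpTo_saturation p D n).measurableSet hp
  have claim : ∀ N, n₀ ≤ N → ∃ B : Fin k → Set H, (∀ i, SaturatedUpTo p N (B i)) ∧
      (∀ i, 0 < μ.real (B i)) ∧ ∑ i, defect μ D' (B i) < 1 ∧
      ∀ n, n₀ ≤ n → n < N → ∃ i, B i ⊆ p n ⁻¹' {q} := by
    intro N hN
    induction N, hN using Nat.le_induction with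
    | base =>
      refine ⟨fun _ => B₀, fun _ => hB₀, fun _ => hB₀pos, ?_, fun n h h' => by omega⟩
      rw [Finset.sum_const, Finset.card_univ, Fintype.card_fin, nsmul_eq_mul]
      calc k * defect μ D' B₀ < k * (k : ℝ)⁻¹ := by gcongr
        _ = 1 := mul_inv_cancel₀ hk0.ne'
    | succ N hN ih =>
      obtain ⟨B, hBs, hBpos, hBdef, hBq⟩ := ih
      have hQ : MeasurableSet (p N ⁻¹' {q}) := hp N (measurableSet_singleton q)
      obtain ⟨B', hB', hpos, hdef, i₀, hi₀⟩ := exists_refinement (μ := μ) (D := D') hQ hε hk1 B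
        hBpos fun i => hmix N _ (hBs i)
      have hsub i : B' i ⊆ B i := by
        rcases hB' i with h | h <;> rw [h]
        exacts [Set.inter_subset_left, Set.sdiff_subset]
      refine ⟨B', fun i => ?_, hpos, hdef.trans_lt hBdef, fun n h h' => ?_⟩
      · rcases hB' i with h | h <;> rw [h]
        · exact ((hBs i).mono N.le_succ).inter (saturatedUpTo_preimage p N _)
        · exact ((hBs i).mono N.le_succ).inter (saturatedUpTo_preimage p N _).compl
      · rcases Nat.lt_succ_iff_lt_or_eq.1 h' with h' | rfl
        · obtain ⟨i, hi⟩ := hBq n h h'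
          exact ⟨i, (hsub i).trans hi⟩
        · exact ⟨i₀, hi₀ ▸ Set.inter_subset_right⟩
  have points : ∀ N, ∃ z : Fin k → H, (∀ i, z i ∈ D) ∧ ∀ n, n₀ ≤ n → n < N →
      ∃ i, p n (z i) = q := by
    intro N
    obtain ⟨B, hBs, hBpos, hBdef, hBq⟩ := claim (max n₀ N) (le_max_left _ _)
    -- Defect below 1 makes `B i` meet `D'`, hence the saturation of `D` at its own level; being
    -- saturated, `B i` then meets `D` itself.
    have : ∀ i, ∃ z ∈ D, z ∈ B i := by
      intro i
      have hlt : defect μ D' (B i) < 1 := by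
        refine lt_of_le_of_lt ?_ hBdef
        exact Finset.single_le_sum (f := fun i => defect μ D' (B i))
          (fun j _ => div_nonneg measureReal_nonneg measureReal_nonneg) (Finset.mem_univ i)
      rw [defect, div_lt_one (hBpos i)] at hlt
      have hne : (B i ∩ D').Nonempty := by
        rw [Set.nonempty_iff_ne_empty]
        intro h
        rw [← measureReal_inter_add_sdiff (s := B i) hD'm, h, measureReal_empty, zero_add] at hlt
        exact lt_irrefl _ hlt
      obtain ⟨y, hyB, hyD⟩ := hne
      obtain ⟨z, hzD, hz⟩ := Set.mem_iInter.1 hyD (max n₀ N)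
      exact ⟨z, hzD, hBs i y z (fun j hj => (hz j hj).symm) hyB⟩
    choose z hzD hzB using this
    refine ⟨z, hzD, fun n h h' => ?_⟩
    obtain ⟨i, hi⟩ := hBq n h (lt_max_of_lt_right h')
    exact ⟨i, hi (hzB i)⟩
  choose z hzD hz using points
  -- Limits in the compact `D` free the points from `N`. For fixed `n` the ultrafilter settles on
  -- one index `i`, and continuity into a discrete space carries `p n = q` to the limit.
  let V : Ultrafilter ℕ := Ultrafilter.of atTop
  have hV : (V : Filter ℕ) ≤ atTop := Ultrafilter.of_le _
  have hlim : ∀ i, ∃ y ∈ D, Tendsto (fun N => z N i) V (𝓝 y) := fun i =>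
    hDc.ultrafilter_le_nhds (V.map fun N => z N i)
      (le_principal_iff.2 (Filter.mem_map.2 (Filter.univ_mem' fun N => hzD N i)))
  choose y hyD hy using hlim
  refine ⟨k, y, hyD, n₀, fun n hn => ?_⟩
  have hev : ∀ᶠ N in (V : Filter ℕ), ∃ i, p n (z N i) = q :=
    hV ((eventually_gt_atTop n).mono fun N hN => hz N n hn hN)
  obtain ⟨i, hi⟩ := Ultrafilter.eventually_exists_iff.1 hev
  refine ⟨i, ?_⟩
  have hyt : Tendsto (fun N => p n (z N i)) V (𝓝 (p n (y i))) :=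
    (hcont n (y i) (hyD i)).tendsto.comp
      (tendsto_nhdsWithin_iff.2 ⟨hy i, Eventually.of_forall fun N => hzD N i⟩)
  rw [nhds_discrete, tendsto_pure] at hyt
  obtain ⟨N, h1, h2⟩ := (hyt.and hi).exists
  exact h1.symm.trans h2

end Hitting

/-! ### Extraction of a mixing subsequence -/

section Extraction

variable {H α : Type*} [Finite α]

lemma finite_setOf_saturatedUpTo (p : ℕ → H → α) (n : ℕ) :
    {B : Set H | SaturatedUpTo p n B}.Finite := by
  let r : H → (Fin n → α) := fun z j => p j z
  refine (Set.finite_range fun W : Set (Fin n → α) => r ⁻¹' W).subset fun B hB => ⟨r '' B, ?_⟩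
  ext z
  refine ⟨?_, fun h => ⟨z, h, rfl⟩⟩
  rintro ⟨z', hz', h⟩
  exact hB z' z (fun j hj => congrFun h ⟨j, hj⟩) hz'

/-- The algebra of an initial segment is finite, so one index serves all its sets at once. -/
lemma exists_strictMono_mixing [MeasurableSpace H] {μ : Measure H} [MeasurableSpace α]
    [DiscreteMeasurableSpace α] {p : ℕ → H → α} (hp : ∀ n, Measurable (p n)) {l : Filter ℕ}
    [l.NeBot] (hl : l ≤ atTop) {ε : ℝ} {S : Set α}
    (h : ∀ B, MeasurableSet B → ∀ q ∈ S, ∀ᶠ n in l, ε * μ.real B ≤ μ.real (B ∩ p n ⁻¹' {q})) :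
    ∃ ns : ℕ → ℕ, StrictMono ns ∧ ∀ k B, SaturatedUpTo (fun j => p (ns j)) k B →
      ∀ q ∈ S, ε * μ.real B ≤ μ.real (B ∩ p (ns k) ⁻¹' {q}) := by
  have key : ∀ N, ∃ n ≥ N, ∀ B, SaturatedUpTo p N B → ∀ q ∈ S,
      ε * μ.real B ≤ μ.real (B ∩ p n ⁻¹' {q}) := by
    intro N
    have h1 : ∀ᶠ n in l, ∀ B ∈ {B | SaturatedUpTo p N B}, ∀ q ∈ S,
        ε * μ.real B ≤ μ.real (B ∩ p n ⁻¹' {q}) :=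
      (eventually_all_finite (finite_setOf_saturatedUpTo p N)).2 fun B hB =>
        (eventually_all_finite (Set.toFinite S)).2 fun q hq =>
          h B (SaturatedUpTo.measurableSet hp hB) q hq
    obtain ⟨n, h2, h3⟩ := (h1.and (hl (eventually_ge_atTop N))).exists
    exact ⟨n, h3, h2⟩
  choose θ hθ hθB using key
  -- The `+ 1` makes the sequence strictly increasing and puts `p n` itself among the functions
  -- whose algebra the next index handles.
  let ns : ℕ → ℕ := fun k => Nat.rec (θ 0) (fun _ n => θ (n + 1)) k
  have hns : StrictMono ns := strictMono_nat_of_lt_succ fun k => hθ (ns k + 1)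
  refine ⟨ns, hns, fun k B hB => ?_⟩
  cases k with
  | zero => exact hθB 0 B fun z z' _ => hB z z' fun j hj => absurd hj (Nat.not_lt_zero j)
  | succ k =>
    exact hθB (ns k + 1) B fun z z' hz => hB z z' fun j hj =>
      hz _ (Nat.lt_succ_of_le (hns.monotone (Nat.le_of_lt_succ hj)))

end Extraction

/-! ### Lusin's theorem for a sequence of finite-valued functions -/

section Lusin

variable {H α : Type*} [TopologicalSpace H] [T2Space H] [MeasurableSpace H]
  [OpensMeasurableSpace H] {μ : Measure H} [IsFiniteMeasure μ] [μ.InnerRegularCompactLTTop]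
  [Finite α] [TopologicalSpace α] [MeasurableSpace α] [DiscreteMeasurableSpace α]

/-- Compact sets inside the level sets are chosen with summably small losses. On `D` each level set
of `p n` is the trace of one of finitely many disjoint compact sets, so it is relatively open. -/
lemma exists_isCompact_continuousOn {p : ℕ → H → α} (hp : ∀ n, Measurable (p n)) {S : Set H}
    (hS : MeasurableSet S) (hμS : 0 < μ S) :
    ∃ D ⊆ S, IsCompact D ∧ 0 < μ D ∧ ∀ n, ContinuousOn (p n) D := by
  have hmeas : ∀ i : ℕ × α, MeasurableSet (S ∩ p i.1 ⁻¹' {i.2}) := fun i =>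
    hS.inter (hp i.1 (measurableSet_singleton _))
  obtain ⟨η, hη, hηsum⟩ := ENNReal.exists_pos_sum_of_countable' hμS.ne' (ℕ × α)
  have hK : ∀ i : ℕ × α, ∃ K ⊆ S ∩ p i.1 ⁻¹' {i.2}, IsCompact K ∧
      μ ((S ∩ p i.1 ⁻¹' {i.2}) \ K) < η i := fun i =>
    (hmeas i).exists_isCompact_sdiff_lt (measure_ne_top _ _) (hη i).ne'
  choose K hKsub hKc hKμ using hK
  have hUc : ∀ n, IsCompact (⋃ a, K (n, a)) := fun n => isCompact_iUnion fun a => hKc _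
  set D := ⋂ n, ⋃ a, K (n, a) with hD
  have hDS : D ⊆ S := fun z hz => by
    obtain ⟨a, ha⟩ := Set.mem_iUnion.1 (Set.mem_iInter.1 hz 0)
    exact (hKsub _ ha).1
  have hDc : IsCompact D :=
    (hUc 0).of_isClosed_subset (isClosed_iInter fun n => (hUc n).isClosed) (Set.iInter_subset _ 0)
  have hdiff : S \ D ⊆ ⋃ i : ℕ × α, (S ∩ p i.1 ⁻¹' {i.2}) \ K i := by
    rintro z ⟨hzS, hzD⟩
    simp only [hD, Set.mem_iInter, not_forall, Set.mem_iUnion, not_exists] at hzD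
    obtain ⟨n, hn⟩ := hzD
    exact Set.mem_iUnion.2 ⟨(n, p n z), ⟨hzS, rfl⟩, hn _⟩
  refine ⟨D, hDS, hDc, ?_, fun n z hz => ?_⟩
  · rw [pos_iff_ne_zero]
    intro h0
    have : μ S < μ S := calc
      μ S ≤ μ (S \ D) + μ D := by
        rw [← measure_inter_add_sdiff S hDc.isClosed.measurableSet, add_comm]
        gcongr
        exact Set.inter_subset_right
      _ = μ (S \ D) := by rw [h0, add_zero]
      _ ≤ ∑' i : ℕ × α, μ ((S ∩ p i.1 ⁻¹' {i.2}) \ K i) :=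
        (measure_mono hdiff).trans (measure_iUnion_le _)
      _ ≤ ∑' i, η i := ENNReal.tsum_le_tsum fun i => (hKμ i).le
      _ < μ S := hηsum
    exact lt_irrefl _ this
  · obtain ⟨a, ha⟩ := Set.mem_iUnion.1 (Set.mem_iInter.1 hz n)
    have hza : p n z = a := (hKsub _ ha).2
    have hcl : IsClosed (⋃ b : {b // b ≠ a}, K (n, b)) :=
      (isCompact_iUnion fun b => hKc _).isClosed
    have hzn : z ∉ ⋃ b : {b // b ≠ a}, K (n, b) := by
      rw [Set.mem_iUnion]
      rintro ⟨b, hb⟩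
      exact b.2 ((hKsub _ hb).2.symm.trans hza)
    refine (continuousWithinAt_const (b := a)).congr_of_eventuallyEq ?_ hza
    filter_upwards [self_mem_nhdsWithin, nhdsWithin_le_nhds (hcl.isOpen_compl.mem_nhds hzn)]
      with y hyD hy
    obtain ⟨b, hb⟩ := Set.mem_iUnion.1 (Set.mem_iInter.1 hyD n)
    have hyb : p n y = b := (hKsub _ hb).2
    by_contra hya
    exact hy (Set.mem_iUnion.2 ⟨⟨b, fun h => hya (hyb.trans h)⟩, hb⟩)

end Lusin

/-! ### Weak limits of bounded sequences of functions -/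

section WeakLimit

lemma exists_tendsto_inner_of_norm_le {E : Type*} [NormedAddCommGroup E] [InnerProductSpace ℝ E]
    [CompleteSpace E] (V : Ultrafilter ℕ) {x : ℕ → E} {C : ℝ} (hx : ∀ n, ‖x n‖ ≤ C) :
    ∃ y : E, ∀ z, Tendsto (fun n => inner ℝ (x n) z) V (𝓝 (inner ℝ y z)) := by
  let F : ℕ → WeakDual ℝ E := fun n => StrongDual.toWeakDual (InnerProductSpace.toDual ℝ E (x n))
  have hK := WeakDual.isCompact_closedBall (𝕜 := ℝ) (E := E) 0 C
  obtain ⟨ψ, -, hψ⟩ := hK.ultrafilter_le_nhds (V.map F) (le_principal_iff.2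
    (Filter.mem_map.2 (Filter.univ_mem' fun n => by simpa [F] using hx n)))
  refine ⟨(InnerProductSpace.toDual ℝ E).symm (WeakDual.toStrongDual ψ), fun z => ?_⟩
  have := ((WeakDual.eval_continuous z).tendsto ψ).comp hψ
  simpa [F, Function.comp_def] using this

variable {H : Type*} [MeasurableSpace H] {μ : Measure H} [IsFiniteMeasure μ]

/-- A bounded sequence in L² has a weak limit along the ultrafilter; testing against indicators
gives the integrals and passes on the bound. -/
lemma exists_tendsto_setIntegral (V : Ultrafilter ℕ) {u : ℕ → H → ℝ} {C : ℝ}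
    (hu : ∀ n, AEStronglyMeasurable (u n) μ) (hb : ∀ n, ∀ᵐ z ∂μ, |u n z| ≤ C) :
    ∃ g : H → ℝ, Measurable g ∧ Integrable g μ ∧ (∀ᵐ z ∂μ, |g z| ≤ C) ∧
      ∀ B, MeasurableSet B → Tendsto (fun n => ∫ z in B, u n z ∂μ) V (𝓝 (∫ z in B, g z ∂μ)) := by
  have hL n : MemLp (u n) 2 μ := MemLp.of_bound (hu n) C (hb n)
  obtain ⟨y, hy⟩ := exists_tendsto_inner_of_norm_le V (x := fun n => (hL n).toLp (u n))
    (C := (μ.real Set.univ) ^ (2 : ℝ≥0∞).toReal⁻¹ * |C|) fun n => by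
      refine (Lp.norm_le_of_ae_bound (abs_nonneg C) ?_)
      filter_upwards [(hL n).coeFn_toLp, hb n] with z h1 h2
      rw [h1]
      exact h2.trans (le_abs_self C)
  have hyint : Integrable y μ := (Lp.memLp y).integrable (by norm_num)
  have hlim : ∀ B, MeasurableSet B →
      Tendsto (fun n => ∫ z in B, u n z ∂μ) V (𝓝 (∫ z in B, y z ∂μ)) := by
    intro B hB
    have := hy (indicatorConstLp 2 hB (measure_ne_top μ B) (1 : ℝ))
    have e (v : Lp ℝ 2 μ) :
        inner ℝ v (indicatorConstLp 2 hB (measure_ne_top μ B) (1 : ℝ)) = ∫ z in B, v z ∂μ := by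
      rw [real_inner_comm, L2.inner_indicatorConstLp_one]
    simp_rw [e] at this
    refine this.congr fun n => integral_congr_ae (ae_restrict_of_ae (hL n).coeFn_toLp)
  have hg : y =ᵐ[μ] (Lp.aestronglyMeasurable y).mk y := (Lp.aestronglyMeasurable y).ae_eq_mk
  refine ⟨(Lp.aestronglyMeasurable y).mk y,
    (Lp.aestronglyMeasurable y).stronglyMeasurable_mk.measurable, hyint.congr hg, ?_, fun B hB => ?_⟩
  · have hui n : Integrable (u n) μ := (hL n).integrable (by norm_num)
    have h1 : y ≤ᵐ[μ] fun _ => C := by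
      refine ae_le_of_forall_setIntegral_le hyint (integrable_const C) fun B hB _ => ?_
      refine le_of_tendsto (hlim B hB) (Eventually.of_forall fun n => ?_)
      exact integral_mono_ae (hui n).integrableOn (integrable_const C).integrableOn
        (ae_restrict_of_ae ((hb n).mono fun z hz => (abs_le.1 hz).2))
    have h2 : (fun _ => -C) ≤ᵐ[μ] y := by
      refine ae_le_of_forall_setIntegral_le (integrable_const (-C)) hyint fun B hB _ => ?_
      refine ge_of_tendsto (hlim B hB) (Eventually.of_forall fun n => ?_)
      exact integral_mono_ae (integrable_const (-C)).integrableOn (hui n).integrableOn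
        (ae_restrict_of_ae ((hb n).mono fun z hz => (abs_le.1 hz).1))
    filter_upwards [hg, h1, h2] with z hz h1 h2
    rw [← hz]
    exact abs_le.2 ⟨h2, h1⟩
  · rw [← integral_congr_ae (ae_restrict_of_ae hg)]
    exact hlim B hB

end WeakLimit

/-! ### Fremlin's alternative and total boundedness in L¹ -/

section Subsequence

/-- The position of `x` with respect to the interval `(-δ, δ)`. -/
noncomputable def threshold (δ x : ℝ) : Fin 3 := if δ ≤ x then 0 else if x ≤ -δ then 1 else 2

lemma measurable_threshold (δ : ℝ) : Measurable (threshold δ) :=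
  Measurable.ite measurableSet_Ici measurable_const
    (Measurable.ite measurableSet_Iic measurable_const measurable_const)

lemma threshold_eq_zero_iff {δ x : ℝ} : threshold δ x = 0 ↔ δ ≤ x := by
  unfold threshold
  split_ifs <;> simp_all

lemma threshold_eq_one_iff {δ x : ℝ} (hδ : 0 < δ) : threshold δ x = 1 ↔ x ≤ -δ := by
  unfold threshold
  split_ifs
  · simp; linarith
  · simp_all
  · simp_all

variable {H : Type*} [MeasurableSpace H] {μ : Measure H} [IsFiniteMeasure μ]

/-- Pointwise |h| + h = 2h⁺, which is at most 4 where `δ ≤ h` and at most `2 * |δ|` elsewhere. -/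
lemma setIntegral_abs_add_le {h : H → ℝ} (hm : Measurable h) (hb : ∀ᵐ z ∂μ, |h z| ≤ 2) {δ : ℝ}
    (B : Set H) :
    ∫ z in B, |h z| ∂μ + ∫ z in B, h z ∂μ ≤ 2 * |δ| * μ.real B + 4 * μ.real (B ∩ {z | δ ≤ h z}) := by
  have hS : MeasurableSet {z | δ ≤ h z} := measurableSet_le measurable_const hm
  have hi : Integrable h (μ.restrict B) :=
    (Integrable.of_bound hm.aestronglyMeasurable 2 hb).restrict
  rw [← integral_add hi.abs hi]
  calc ∫ z in B, (|h z| + h z) ∂μ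
      ≤ ∫ z in B, (2 * |δ| + {z | δ ≤ h z}.indicator (fun _ => 4) z) ∂μ := by
        refine integral_mono_ae (hi.abs.add hi)
          ((integrable_const _).add ((integrable_const _).indicator hS)) ?_
        filter_upwards [ae_restrict_of_ae hb] with z hz
        have := abs_le.1 hz
        by_cases hδ : δ ≤ h z
        · rw [Set.indicator_of_mem (by exact hδ)]
          have := abs_nonneg δ
          linarith
        · rw [Set.indicator_of_notMem (by exact hδ)]
          have h1 := le_abs_self δ
          have h2 := abs_nonneg δ
          rcases abs_cases (h z) with h3 | h3 <;> linarith
    _ = 2 * |δ| * μ.real B + 4 * μ.real (B ∩ {z | δ ≤ h z}) := by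
        rw [integral_add (integrable_const _) ((integrable_const _).indicator hS),
          integral_indicator hS, Measure.restrict_restrict hS]
        simp [Set.inter_comm, mul_comm]

/-- A sequence of measurable functions that oscillates uniformly: it tends weakly to `0`, whereas
its absolute values do not. -/
lemma exists_oscillation (V : Ultrafilter ℕ) (hV : (V : Filter ℕ) ≤ atTop) {h : ℕ → H → ℝ}
    (hm : ∀ n, Measurable (h n)) (hb : ∀ n, ∀ᵐ z ∂μ, |h n z| ≤ 2)
    (hweak : ∀ B, MeasurableSet B → Tendsto (fun n => ∫ z in B, h n z ∂μ) V (𝓝 0))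
    {ε : ℝ} (hε : 0 < ε) (hnorm : ∀ᶠ n in atTop, ε ≤ ∫ z, |h n z| ∂μ) :
    ∃ E, MeasurableSet E ∧ 0 < μ E ∧ ∃ δ > 0, ∃ η > 0, ∀ B, MeasurableSet B →
      (∀ᶠ n in (V : Filter ℕ),
        η * (μ.restrict E).real B ≤ (μ.restrict E).real (B ∩ {z | δ ≤ h n z})) ∧
      ∀ᶠ n in (V : Filter ℕ),
        η * (μ.restrict E).real B ≤ (μ.restrict E).real (B ∩ {z | h n z ≤ -δ}) := by
  obtain ⟨ρ, hρm, hρi, -, hρ⟩ := exists_tendsto_setIntegral (μ := μ) V (u := fun n z => |h n z|)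
    (C := 2) (fun n => (hm n).abs.aestronglyMeasurable) fun n => (hb n).mono fun z hz => by
      rwa [abs_abs]
  have hρε : ε ≤ ∫ z, ρ z ∂μ := by
    have := hρ _ MeasurableSet.univ
    simp only [Measure.restrict_univ] at this
    exact ge_of_tendsto this (hV hnorm)
  set M := μ.real Set.univ
  have hM : 0 ≤ M := measureReal_nonneg
  -- The level `c` satisfies `c * M < ε ≤ ∫ ρ`, so `{c < ρ}` is not null; the `+ 1` covers `M = 0`.
  set c := ε / (M + 1) with hc
  have hc0 : 0 < c := by positivity
  have hcM : c * M < ε := by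
    rw [hc, div_mul_eq_mul_div, div_lt_iff₀ (by positivity)]
    nlinarith
  set E := {z | c < ρ z} with hE
  have hEm : MeasurableSet E := measurableSet_lt measurable_const hρm
  have hEpos : 0 < μ E := by
    rw [pos_iff_ne_zero]
    intro h0
    have h1 : ∀ᵐ z ∂μ, ρ z ≤ c := by
      rw [ae_iff]; simpa [hE, not_le] using h0
    have h2 : ∫ z, ρ z ∂μ ≤ ∫ _z, c ∂μ := integral_mono_ae hρi (integrable_const _) h1
    rw [integral_const, smul_eq_mul] at h2
    change _ ≤ M * c at h2
    linarith
  -- On `B ∩ E`, of measure `b`, the integral of |h_n| exceeds 3cb/4 and that of h_n is below cb/4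
  -- in modulus, so |h_n| ± h_n integrates to more than cb/2. The threshold c/8 absorbs cb/4; the
  -- rest needs a set of measure over cb/16.
  refine ⟨E, hEm, hEpos, c / 8, by positivity, c / 16, by positivity, fun B hB => ?_⟩
  have hBE := hB.inter hEm
  set b := μ.real (B ∩ E) with hb'
  have hr (A : Set H) (hA : MeasurableSet A) :
      (μ.restrict E).real (B ∩ A) = μ.real (B ∩ E ∩ A) := by
    rw [measureReal_restrict_apply (hB.inter hA), Set.inter_right_comm]
  have hrB : (μ.restrict E).real B = b := measureReal_restrict_apply hB
  rcases (show 0 ≤ b from measureReal_nonneg).eq_or_lt with h0 | hpos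
  · constructor <;> refine Eventually.of_forall fun n => ?_ <;> rw [hrB, ← h0, mul_zero] <;>
      exact measureReal_nonneg
  have hρB : c * b ≤ ∫ z in B ∩ E, ρ z ∂μ := by
    calc c * b = ∫ _z in B ∩ E, c ∂μ := by
          rw [setIntegral_const, smul_eq_mul, mul_comm]
      _ ≤ _ := setIntegral_mono_on (integrable_const _).integrableOn hρi.integrableOn hBE
          fun z hz => le_of_lt hz.2
  have ev1 : ∀ᶠ n in (V : Filter ℕ), 3 / 4 * (c * b) < ∫ z in B ∩ E, |h n z| ∂μ :=
    (hρ _ hBE).eventually (lt_mem_nhds (by nlinarith [mul_pos hc0 hpos]))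
  have ev2 : ∀ᶠ n in (V : Filter ℕ), |∫ z in B ∩ E, h n z ∂μ| < c * b / 4 := by
    have := (hweak _ hBE).abs
    rw [abs_zero] at this
    exact this.eventually (gt_mem_nhds (by positivity))
  have habs : |c / 8| = c / 8 := abs_of_pos (by positivity)
  constructor
  · filter_upwards [ev1, ev2] with n h1 h2
    have h3 := setIntegral_abs_add_le (hm n) (hb n) (δ := c / 8) (B ∩ E)
    rw [hrB, hr _ (measurableSet_le measurable_const (hm n))]
    rw [habs, ← hb'] at h3
    have := (abs_lt.1 h2).1
    nlinarith
  · filter_upwards [ev1, ev2] with n h1 h2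
    have h3 := setIntegral_abs_add_le (h := fun z => -h n z) (hm n).neg
      ((hb n).mono fun z hz => by rwa [abs_neg]) (δ := c / 8) (B ∩ E)
    have e : {z | c / 8 ≤ -h n z} = {z | h n z ≤ -(c / 8)} := by
      ext z; simp only [Set.mem_ofPred_eq]; constructor <;> intro h <;> linarith
    rw [hrB, hr _ (measurableSet_le (hm n) measurable_const)]
    simp only [abs_neg, integral_neg] at h3
    rw [e, habs, ← hb'] at h3
    have := (abs_lt.1 h2).2
    nlinarith

variable [TopologicalSpace H] [T2Space H] [OpensMeasurableSpace H] [μ.InnerRegularCompactLTTop]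

/-- Fremlin's alternative, for bounded sequences: a sequence that is separated in `L¹` has a
subsequence with a nonmeasurable pointwise cluster point. -/
theorem exists_ultrafilter_forall_not_tendsto {u : ℕ → H → ℝ}
    (hu : ∀ n, AEStronglyMeasurable (u n) μ) (hb : ∀ n, ∀ᵐ z ∂μ, |u n z| ≤ 1) {ε : ℝ} (hε : 0 < ε)
    (hsep : ∀ m n, m < n → ε ≤ ∫ z, |u m z - u n z| ∂μ) :
    ∃ V : Ultrafilter ℕ, ∀ w : H → ℝ, AEMeasurable w μ →
      ¬ ∀ z, Tendsto (fun n => u n z) V (𝓝 (w z)) := by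
  let V₀ : Ultrafilter ℕ := Ultrafilter.of atTop
  have hV₀ : (V₀ : Filter ℕ) ≤ atTop := Ultrafilter.of_le _
  obtain ⟨g, hgm, hgi, hgb, hg⟩ := exists_tendsto_setIntegral V₀ hu hb
  let h : ℕ → H → ℝ := fun n z => (hu n).mk (u n) z - g z
  have hue n : u n =ᵐ[μ] (hu n).mk (u n) := (hu n).ae_eq_mk
  have hui n : Integrable (u n) μ := Integrable.of_bound (hu n) 1 (hb n)
  have hhe n : (fun z => u n z - g z) =ᵐ[μ] h n := (hue n).mono fun z hz => by
    simp only [h, ← hz]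
  have hhm n : Measurable (h n) := (hu n).stronglyMeasurable_mk.measurable.sub hgm
  have hhb n : ∀ᵐ z ∂μ, |h n z| ≤ 2 := by
    filter_upwards [hhe n, hb n, hgb] with z h1 h2 h3
    rw [← h1]
    linarith [abs_sub (u n z) (g z)]
  have hhi n : Integrable (h n) μ := ((hui n).sub hgi).congr (hhe n)
  have hweak : ∀ B, MeasurableSet B → Tendsto (fun n => ∫ z in B, h n z ∂μ) V₀ (𝓝 0) := by
    intro B hB
    have := (hg B hB).sub_const (∫ z in B, g z ∂μ)
    rw [sub_self] at this
    refine this.congr fun n => ?_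
    rw [← integral_sub (hui n).integrableOn hgi.integrableOn]
    exact integral_congr_ae (ae_restrict_of_ae (hhe n))
  -- By separation, at most one `h n` has L¹ norm below `ε / 2`.
  have hnorm : ∀ᶠ n in atTop, ε / 2 ≤ ∫ z, |h n z| ∂μ := by
    have htri : ∀ m n, m < n → ε ≤ ∫ z, |h m z| ∂μ + ∫ z, |h n z| ∂μ := by
      intro m n hmn
      refine (hsep m n hmn).trans ?_
      rw [← integral_add (hhi m).abs (hhi n).abs]
      refine integral_mono_ae ((hui m).sub (hui n)).abs ((hhi m).abs.add (hhi n).abs) ?_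
      filter_upwards [hhe m, hhe n] with z h1 h2
      simp only [← h1, ← h2]
      calc |u m z - u n z| = |(u m z - g z) - (u n z - g z)| := by ring_nf
        _ ≤ _ := abs_sub _ _
    by_cases hex : ∃ m, ∫ z, |h m z| ∂μ < ε / 2
    · obtain ⟨m, hm⟩ := hex
      filter_upwards [eventually_gt_atTop m] with n hn
      linarith [htri m n hn]
    · push Not at hex
      exact Eventually.of_forall hex
  obtain ⟨E, hEm, hEpos, δ, hδ, η, hη, hosc⟩ :=
    exists_oscillation V₀ hV₀ hhm hhb hweak (half_pos hε) hnorm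
  let p : ℕ → H → Fin 3 := fun n z => threshold δ (h n z)
  have hpm n : Measurable (p n) := (measurable_threshold δ).comp (hhm n)
  have hp0 n : p n ⁻¹' {0} = {z | δ ≤ h n z} := by
    ext z; simp [p, threshold_eq_zero_iff]
  have hp1 n : p n ⁻¹' {1} = {z | h n z ≤ -δ} := by
    ext z; simp [p, threshold_eq_one_iff hδ]
  obtain ⟨ns, hns, hmix⟩ := exists_strictMono_mixing (μ := μ.restrict E) hpm hV₀ (ε := η)
    (S := {0, 1}) (fun B hB q hq => by
      rcases hq with rfl | rfl
      · simpa only [hp0] using (hosc B hB).1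
      · simpa only [hp1] using (hosc B hB).2)
  let V : Ultrafilter ℕ := Ultrafilter.of (map ns atTop)
  have hV : (V : Filter ℕ) ≤ map ns atTop := Ultrafilter.of_le _
  refine ⟨V, fun w hw hlim => ?_⟩
  obtain ⟨t, hts, htm, htμ⟩ := exists_measurable_superset_of_null (μ := μ)
    (s := {z | ¬ ((∀ n, u n z = (hu n).mk (u n) z) ∧ w z = hw.mk w z)})
    (ae_iff.1 ((ae_all_iff.2 hue).and hw.ae_eq_mk))
  have hgood : ∀ z ∉ t, Tendsto (fun n => h n z) V (𝓝 (hw.mk w z - g z)) := by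
    intro z hz
    have hz' : (∀ n, u n z = (hu n).mk (u n) z) ∧ w z = hw.mk w z := by
      by_contra hcon
      exact hz (hts hcon)
    simp only [h, ← hz'.1, ← hz'.2]
    exact (hlim z).sub_const _
  -- If `S` were not null, it would contain finitely many points one of which takes the value `q` at
  -- each late index of the subsequence, although each of them avoids `q` along `V`.
  have hcore : ∀ q ∈ ({0, 1} : Set (Fin 3)), ∀ S, MeasurableSet S → S ⊆ E →
      (∀ z ∈ S, ∀ᶠ n in (V : Filter ℕ), p n z ≠ q) → μ S = 0 := by
    intro q hq S hS hSE hSV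
    by_contra hne
    obtain ⟨D, hDS, hDc, hDpos, hDcont⟩ :=
      exists_isCompact_continuousOn hpm hS (pos_iff_ne_zero.2 hne)
    obtain ⟨k, z, hzD, n₀, hhit⟩ := exists_finite_hitting (μ := μ.restrict E)
      (p := fun j => p (ns j)) (fun j => hpm _) hη (q := q) (fun n B hB => hmix n B hB q hq) hDc
      (fun n => hDcont _)
      (by rwa [Measure.restrict_apply hDc.isClosed.measurableSet,
        Set.inter_eq_left.2 (hDS.trans hSE)])
    have h1 : ∀ᶠ n in (V : Filter ℕ), ∀ i, p n (z i) ≠ q :=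
      eventually_all.2 fun i => hSV _ (hDS (hzD i))
    have h2 : ∀ᶠ n in (V : Filter ℕ), ∃ i, p n (z i) = q :=
      hV (eventually_map.2 ((eventually_ge_atTop n₀).mono hhit))
    obtain ⟨n, h3, i, h4⟩ := (h1.and h2).exists
    exact h3 i h4
  have hdm : Measurable fun z => hw.mk w z - g z := hw.measurable_mk.sub hgm
  -- Where the limit is positive, `h n ≤ -δ` fails along `V`; where it is nonpositive, `δ ≤ h n`
  -- fails. Both parts of `E` are therefore null.
  have hS1 : μ ((E \ t) ∩ {z | 0 < hw.mk w z - g z}) = 0 := by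
    refine hcore 1 (by simp) _ ((hEm.diff htm).inter (measurableSet_lt measurable_const hdm))
      (fun z hz => hz.1.1) fun z hz => ?_
    filter_upwards [(hgood z hz.1.2).eventually (lt_mem_nhds hz.2)] with n hn h1
    have := (threshold_eq_one_iff hδ).1 h1
    linarith
  have hS2 : μ ((E \ t) \ {z | 0 < hw.mk w z - g z}) = 0 := by
    refine hcore 0 (by simp) _ ((hEm.diff htm).diff (measurableSet_lt measurable_const hdm))
      (fun z hz => hz.1.1) fun z hz => ?_
    have hz2 : hw.mk w z - g z < δ := lt_of_le_of_lt (not_lt.1 hz.2) hδ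
    filter_upwards [(hgood z hz.1.2).eventually (gt_mem_nhds hz2)] with n hn h1
    have := threshold_eq_zero_iff.1 h1
    linarith
  have : μ E ≤ 0 := by
    calc μ E ≤ μ (t ∪ ((E \ t) ∩ {z | 0 < hw.mk w z - g z}) ∪
          ((E \ t) \ {z | 0 < hw.mk w z - g z})) := measure_mono (by
          intro z hz
          by_cases h1 : z ∈ t
          · exact Or.inl (Or.inl h1)
          · by_cases h2 : 0 < hw.mk w z - g z
            · exact Or.inl (Or.inr ⟨⟨hz, h1⟩, h2⟩)
            · exact Or.inr ⟨⟨hz, h1⟩, h2⟩)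
      _ ≤ μ t + 0 + 0 := by
          refine (measure_union_le _ _).trans (add_le_add ((measure_union_le _ _).trans ?_) hS2.le)
          exact add_le_add le_rfl hS1.le
      _ = 0 := by rw [htμ]; simp
  exact hEpos.not_ge this

/-- The scalar compositions of a weakly measurable, weakly bounded function with the functionals of
the dual unit ball are totally bounded in `L¹`. -/
theorem exists_finset_dual_net {F : Type*} [NormedAddCommGroup F] [NormedSpace ℝ F] {f : H → F}
    (hf : ∀ φ : StrongDual ℝ F, AEStronglyMeasurable (fun z => φ (f z)) μ)
    (hb : ∀ φ : StrongDual ℝ F, ‖φ‖ ≤ 1 → ∀ᵐ z ∂μ, |φ (f z)| ≤ 1) {ε : ℝ} (hε : 0 < ε) :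
    ∃ s : Finset (StrongDual ℝ F), (∀ ψ ∈ s, ‖ψ‖ ≤ 1) ∧ ∀ φ : StrongDual ℝ F, ‖φ‖ ≤ 1 →
      ∃ ψ ∈ s, ∫ z, |ψ (f z) - φ (f z)| ∂μ < ε := by
  by_contra hcon
  push Not at hcon
  obtain ⟨φ, hφ, hsep⟩ := exists_seq_of_forall_finset_exists
    (fun φ : StrongDual ℝ F => ‖φ‖ ≤ 1) (fun ψ φ => ε ≤ ∫ z, |ψ (f z) - φ (f z)| ∂μ) hcon
  obtain ⟨V, hV⟩ := exists_ultrafilter_forall_not_tendsto (fun n => hf (φ n))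
    (fun n => hb _ (hφ n)) hε hsep
  have hK := WeakDual.isCompact_closedBall (𝕜 := ℝ) (E := F) 0 1
  obtain ⟨ψ, -, hψ⟩ := hK.ultrafilter_le_nhds (V.map fun n => StrongDual.toWeakDual (φ n))
    (le_principal_iff.2 (Filter.mem_map.2 (Filter.univ_mem' fun n => by simpa using hφ n)))
  refine hV (fun z => WeakDual.toStrongDual ψ (f z)) (hf _).aemeasurable fun z => ?_
  exact ((WeakDual.eval_continuous (f z)).tendsto ψ).comp hψ

end Subsequence

/-! ### Convergence of partition averages in Pettis norm -/

section Averages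

variable {H : Type*} [MeasurableSpace H]

/-- The partition into the level sets of a simple function. -/
lemma exists_measPartition_const (s : SimpleFunc H ℝ) :
    ∃ π : MeasPartition H, ∀ A ∈ π.parts, ∃ c, ∀ z ∈ (A : Set H), s z = c := by
  classical
  let P : Finpartition (Set.univ : Set H) :=
    { parts := s.range.image fun c => s ⁻¹' {c}
      supIndep := by
        rw [Finset.supIndep_iff_pairwiseDisjoint]
        intro A hA B hB hAB
        simp only [Finset.coe_image, Set.mem_image] at hA hB
        obtain ⟨a, -, rfl⟩ := hA
        obtain ⟨b, -, rfl⟩ := hB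
        refine Set.disjoint_left.2 fun z h1 h2 => hAB ?_
        have h1 : s z = a := h1
        have h2 : s z = b := h2
        rw [← h1, ← h2]
      sup_parts := by
        refine Set.eq_univ_of_forall fun z => ?_
        rw [Finset.sup_set_eq_biUnion]
        exact Set.mem_biUnion (Finset.mem_image_of_mem _ (s.mem_range_self z)) rfl
      bot_notMem := by
        intro h
        obtain ⟨c, hc, h⟩ := Finset.mem_image.1 h
        obtain ⟨z, rfl⟩ := SimpleFunc.mem_range.1 hc
        exact Set.notMem_empty z (h.le (rfl : s z = s z)) }
  refine ⟨P.toMeasurableSet MeasurableSet.univ ?_, ?_⟩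
  · intro A hA
    obtain ⟨c, -, rfl⟩ := Finset.mem_image.1 hA
    exact s.measurableSet_preimage _
  · rintro A hA
    have hA' : (A : Set H) ∈ P.parts := by
      simpa [Finpartition.toSubtype] using hA
    obtain ⟨c, -, hc⟩ := Finset.mem_image.1 hA'
    exact ⟨c, fun z hz => by rw [← hc] at hz; exact hz⟩

lemma MeasPartition.pairwiseDisjoint (π : MeasPartition H) :
    (π.parts : Set (Subtype (MeasurableSet : Set H → Prop))).PairwiseDisjoint
      (fun A => (A : Set H)) :=
  π.pairwiseDisjoint_apply (fun _ _ => rfl) rfl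

lemma MeasPartition.biUnion_parts (π : MeasPartition H) : ⋃ A ∈ π.parts, (A : Set H) = Set.univ := by
  rw [← Finset.sup_set_eq_biUnion, π.sup_parts_apply (fun _ _ => rfl) rfl]

variable {F : Type*} [NormedAddCommGroup F] [NormedSpace ℝ F] {μ : Measure H}

lemma partitionAverage_of_mem (m : NormedVectorMeasure H F) (π : MeasPartition H)
    {A : Subtype (MeasurableSet : Set H → Prop)} (hA : A ∈ π.parts) {z : H} (hz : z ∈ (A : Set H)) :
    partitionAverage m μ π z = (μ.real (A : Set H))⁻¹ • m A := by
  rw [partitionAverage, Finset.sum_eq_single A, Set.indicator_of_mem hz]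
  · intro B hB hBA
    refine Set.indicator_of_notMem (fun hzB => ?_) _
    exact Set.disjoint_left.1 (π.pairwiseDisjoint hB hA hBA) hzB hz
  · exact fun h => absurd hA h

/-- Averaging fixes `c` and contracts L¹: one copy of the bound pays for the average of `g - c`, the
other for `g - c`. -/
lemma setLIntegral_average_sub_le [IsFiniteMeasure μ] {g : H → ℝ} (hg : Integrable g μ)
    (c : ℝ) (A : Set H) :
    ∫⁻ z in A, ‖(μ.real A)⁻¹ * ∫ y in A, g y ∂μ - g z‖ₑ ∂μ ≤ 2 * ∫⁻ z in A, ‖g z - c‖ₑ ∂μ := by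
  rcases eq_or_ne (μ A) 0 with h0 | h0
  · simp [Measure.restrict_eq_zero.2 h0]
  have hpos : 0 < μ.real A := ENNReal.toReal_pos h0 (measure_ne_top _ _)
  have e : (μ.real A)⁻¹ * ∫ y in A, g y ∂μ - c = (μ.real A)⁻¹ * ∫ y in A, (g y - c) ∂μ := by
    rw [integral_sub hg.integrableOn (integrable_const _), setIntegral_const, smul_eq_mul]
    field_simp
  have h1 : ‖(μ.real A)⁻¹ * ∫ y in A, g y ∂μ - c‖ₑ * μ A ≤ ∫⁻ z in A, ‖g z - c‖ₑ ∂μ := by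
    rw [e, enorm_mul]
    calc ‖(μ.real A)⁻¹‖ₑ * ‖∫ y in A, (g y - c) ∂μ‖ₑ * μ A
        ≤ ‖(μ.real A)⁻¹‖ₑ * (∫⁻ z in A, ‖g z - c‖ₑ ∂μ) * μ A := by
          gcongr
          exact enorm_integral_le_lintegral_enorm _
      _ = (‖(μ.real A)⁻¹‖ₑ * μ A) * ∫⁻ z in A, ‖g z - c‖ₑ ∂μ := by ring
      _ = ∫⁻ z in A, ‖g z - c‖ₑ ∂μ := by
          rw [← ENNReal.ofReal_toReal (measure_ne_top μ A), ← measureReal_def,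
            Real.enorm_eq_ofReal (by positivity), ← ENNReal.ofReal_mul (by positivity),
            inv_mul_cancel₀ hpos.ne', ENNReal.ofReal_one, one_mul]
  calc ∫⁻ z in A, ‖(μ.real A)⁻¹ * ∫ y in A, g y ∂μ - g z‖ₑ ∂μ
      ≤ ∫⁻ z in A, (‖(μ.real A)⁻¹ * ∫ y in A, g y ∂μ - c‖ₑ + ‖g z - c‖ₑ) ∂μ := by
        refine lintegral_mono fun z => ?_
        rw [← enorm_neg (g z - c)]
        refine le_trans (le_of_eq ?_) (enorm_add_le _ _)
        congr 1
        ring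
    _ = ‖(μ.real A)⁻¹ * ∫ y in A, g y ∂μ - c‖ₑ * μ A + ∫⁻ z in A, ‖g z - c‖ₑ ∂μ := by
        rw [lintegral_add_left measurable_const, setLIntegral_const]
    _ ≤ 2 * ∫⁻ z in A, ‖g z - c‖ₑ ∂μ := by
        rw [two_mul]
        gcongr

lemma lintegral_partitionAverage_sub_le [IsFiniteMeasure μ] {m : NormedVectorMeasure H F}
    {f : H → F} (hf : IsPettisDensity m μ f) (φ : StrongDual ℝ F) (s : SimpleFunc H ℝ)
    {π : MeasPartition H} (hπ : ∀ A ∈ π.parts, ∃ c, ∀ z ∈ (A : Set H), s z = c) :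
    ∫⁻ z, ‖φ (partitionAverage m μ π z - f z)‖ₑ ∂μ ≤ 2 * ∫⁻ z, ‖φ (f z) - s z‖ₑ ∂μ := by
  have split (k : H → ℝ≥0∞) : ∫⁻ z, k z ∂μ = ∑ A ∈ π.parts, ∫⁻ z in (A : Set H), k z ∂μ := by
    rw [← lintegral_biUnion_finset π.pairwiseDisjoint fun A _ => A.2,
      MeasPartition.biUnion_parts π, setLIntegral_univ]
  rw [split, split, Finset.mul_sum]
  refine Finset.sum_le_sum fun A hA => ?_
  obtain ⟨c, hc⟩ := hπ A hA
  calc ∫⁻ z in (A : Set H), ‖φ (partitionAverage m μ π z - f z)‖ₑ ∂μ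
      = ∫⁻ z in (A : Set H), ‖(μ.real (A : Set H))⁻¹ * ∫ y in (A : Set H), φ (f y) ∂μ
          - φ (f z)‖ₑ ∂μ := by
        refine setLIntegral_congr_fun A.2 fun z hz => ?_
        rw [partitionAverage_of_mem m π hA hz, map_sub, map_smul, hf.2 A A.2 φ, smul_eq_mul]
    _ ≤ 2 * ∫⁻ z in (A : Set H), ‖φ (f z) - c‖ₑ ∂μ :=
        setLIntegral_average_sub_le (hf.1.1 φ) c A
    _ = 2 * ∫⁻ z in (A : Set H), ‖φ (f z) - s z‖ₑ ∂μ := by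
        congr 1
        refine setLIntegral_congr_fun A.2 fun z hz => ?_
        rw [hc z hz]

lemma IsPettisDensity.ae_abs_le [IsFiniteMeasure μ] {m : NormedVectorMeasure H F}
    (hm : ∀ A, MeasurableSet A → ‖m A‖ ≤ μ.real A) {f : H → F} (hf : IsPettisDensity m μ f)
    {φ : StrongDual ℝ F} (hφ : ‖φ‖ ≤ 1) : ∀ᵐ z ∂μ, |φ (f z)| ≤ 1 := by
  have hb : ∀ A, MeasurableSet A → |∫ z in A, φ (f z) ∂μ| ≤ μ.real A := fun A hA => by
    rw [← hf.2 A hA φ]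
    exact (φ.le_of_opNorm_le hφ _).trans ((one_mul _).trans_le (hm A hA))
  have h1 : (fun z => φ (f z)) ≤ᵐ[μ] fun _ => 1 :=
    ae_le_of_forall_setIntegral_le (hf.1.1 φ) (integrable_const _) fun A hA _ => by
      rw [setIntegral_const, smul_eq_mul, mul_one]
      exact (abs_le.1 (hb A hA)).2
  have h2 : (fun _ => -1) ≤ᵐ[μ] fun z => φ (f z) :=
    ae_le_of_forall_setIntegral_le (integrable_const _) (hf.1.1 φ) fun A hA _ => by
      rw [setIntegral_const, smul_eq_mul, mul_neg_one]
      exact (abs_le.1 (hb A hA)).1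
  filter_upwards [h1, h2] with z h1 h2 using abs_le.2 ⟨h2, h1⟩

variable [TopologicalSpace H] [T2Space H] [OpensMeasurableSpace H] [IsFiniteMeasure μ]
  [μ.InnerRegularCompactLTTop]

/-- The averages over finite partitions of a bounded vector measure converge in Pettis norm to each
of its Pettis densities with respect to a finite Radon measure. -/
theorem tendsto_pettisNorm_partitionAverage_sub {m : NormedVectorMeasure H F}
    (hm : ∀ A, MeasurableSet A → ‖m A‖ ≤ μ.real A) {f : H → F} (hf : IsPettisDensity m μ f) :
    Tendsto (fun π : MeasPartition H => pettisNorm (fun z => partitionAverage m μ π z - f z) μ)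
      atBot (𝓝 0) := by
  rw [ENNReal.tendsto_nhds_zero]
  intro ε hε
  -- One `r` is the radius of the net, the other the error of the simple functions; the 2 comes from
  -- averaging.
  obtain ⟨r, hr, hrε⟩ : ∃ r : ℝ, 0 < r ∧ 2 * (ENNReal.ofReal r + ENNReal.ofReal r) ≤ ε := by
    rcases eq_or_ne ε ⊤ with rfl | hne
    · exact ⟨1, one_pos, le_top⟩
    have hp : 0 < ε.toReal := ENNReal.toReal_pos hε.ne' hne
    refine ⟨ε.toReal / 4, by positivity, ?_⟩
    rw [← ENNReal.ofReal_add (by positivity) (by positivity),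
      ← ENNReal.ofReal_ofNat, ← ENNReal.ofReal_mul (by norm_num)]
    refine ENNReal.ofReal_le_of_le_toReal (le_of_eq ?_)
    ring
  obtain ⟨S, hS, hnet⟩ := exists_finset_dual_net (μ := μ) (f := f)
    (fun φ => (hf.1.1 φ).aestronglyMeasurable) (fun φ hφ => hf.ae_abs_le hm hφ) hr
  have happrox : ∀ ψ : StrongDual ℝ F, ∃ s : SimpleFunc H ℝ,
      ∫⁻ z, ‖ψ (f z) - s z‖ₑ ∂μ ≤ ENNReal.ofReal r := by
    intro ψ
    obtain ⟨s, hs, -⟩ := (memLp_one_iff_integrable.2 (hf.1.1 ψ)).exists_simpleFunc_eLpNorm_sub_lt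
      ENNReal.one_ne_top (ENNReal.ofReal_pos.2 hr).ne'
    rw [eLpNorm_one_eq_lintegral_enorm] at hs
    exact ⟨s, hs.le⟩
  choose s hs using happrox
  choose π₀ hπ₀ using fun ψ => exists_measPartition_const (s ψ)
  filter_upwards [(Finset.eventually_all S).2 fun ψ _ => eventually_le_atBot (π₀ ψ)] with π hπ
  refine iSup₂_le fun φ hφ => ?_
  obtain ⟨ψ, hψS, hψ⟩ := hnet φ hφ
  have hconst : ∀ A ∈ π.parts, ∃ c, ∀ z ∈ (A : Set H), s ψ z = c := by
    intro A hA
    obtain ⟨B, hB, hAB⟩ := hπ ψ hψS hA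
    obtain ⟨c, hc⟩ := hπ₀ ψ B hB
    exact ⟨c, fun z hz => hc z (hAB hz)⟩
  refine (lintegral_partitionAverage_sub_le hf φ (s ψ) hconst).trans (le_trans ?_ hrε)
  gcongr
  calc ∫⁻ z, ‖φ (f z) - s ψ z‖ₑ ∂μ
      ≤ ∫⁻ z, (‖ψ (f z) - φ (f z)‖ₑ + ‖ψ (f z) - s ψ z‖ₑ) ∂μ := by
        refine lintegral_mono fun z => ?_
        rw [← enorm_neg (ψ (f z) - φ (f z))]
        refine le_trans (le_of_eq ?_) (enorm_add_le _ _)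
        congr 1
        ring
    _ = ∫⁻ z, ‖ψ (f z) - φ (f z)‖ₑ ∂μ + ∫⁻ z, ‖ψ (f z) - s ψ z‖ₑ ∂μ :=
        lintegral_add_left' ((hf.1.1 ψ).sub (hf.1.1 φ)).aestronglyMeasurable.enorm _
    _ ≤ ENNReal.ofReal r + ENNReal.ofReal r := by
        gcongr
        · exact (ofReal_integral_norm_eq_lintegral_enorm ((hf.1.1 ψ).sub (hf.1.1 φ))).symm.trans_le
            (ENNReal.ofReal_le_ofReal hψ.le)
        · exact hs ψ

end Averages

/-! ### Alexandroff's theorem -/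

section ScalarRegular

lemma additive_empty {H : Type*} [MeasurableSpace H] {G : Type*} [AddCommGroup G] {l : Set H → G}
    (hadd : ∀ A B, MeasurableSet A → MeasurableSet B → Disjoint A B → l (A ∪ B) = l A + l B) :
    l ∅ = 0 := by
  have := hadd ∅ ∅ MeasurableSet.empty MeasurableSet.empty (Set.disjoint_empty _)
  simpa using this

variable {H : Type*} [MeasurableSpace H] {l : Set H → ℝ}

lemma abs_le_sum_of_subset_biUnion
    (hadd : ∀ A B, MeasurableSet A → MeasurableSet B → Disjoint A B → l (A ∪ B) = l A + l B)
    {C : ℕ → Set H} (hC : ∀ n, MeasurableSet (C n)) {η : ℕ → ℝ}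
    (hη : ∀ n B, MeasurableSet B → B ⊆ C n → |l B| ≤ η n) (N : ℕ) :
    ∀ B, MeasurableSet B → B ⊆ ⋃ n < N, C n → |l B| ≤ ∑ n ∈ Finset.range N, η n := by
  induction N with
  | zero =>
    intro B _ hsub
    have : B = ∅ := by simpa [Set.subset_empty_iff] using hsub
    simp [this, additive_empty hadd]
  | succ N ih =>
    intro B hB hsub
    have e : l B = l (B \ C N) + l (B ∩ C N) := by
      rw [← hadd _ _ (hB.diff (hC N)) (hB.inter (hC N))
        (Set.disjoint_left.2 fun z h1 h2 => h1.2 h2.2), Set.sdiff_union_inter]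
    rw [e, Finset.sum_range_succ]
    refine (abs_add_le _ _).trans (add_le_add (ih _ (hB.diff (hC N)) ?_)
      (hη N _ (hB.inter (hC N)) Set.inter_subset_right))
    rintro z ⟨hzB, hzC⟩
    obtain ⟨n, hn, hz⟩ := Set.mem_iUnion₂.1 (hsub hzB)
    rcases Nat.lt_succ_iff_lt_or_eq.1 hn with hn | rfl
    · exact Set.mem_iUnion₂.2 ⟨n, hn, hz⟩
    · exact absurd hz hzC

/-- Alexandroff's theorem: a regular additive set function is continuous at the empty set. -/
theorem IsRegularSetFun.tendsto_zero [TopologicalSpace H] [T2Space H]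
    [OpensMeasurableSpace H] (hl : IsRegularSetFun l)
    (hadd : ∀ A B, MeasurableSet A → MeasurableSet B → Disjoint A B → l (A ∪ B) = l A + l B)
    {A : ℕ → Set H} (hA : ∀ n, MeasurableSet (A n)) (hanti : Antitone A) (hempty : ⋂ n, A n = ∅) :
    Tendsto (fun n => l (A n)) atTop (𝓝 0) := by
  rw [Metric.tendsto_atTop]
  intro ε hε
  obtain ⟨η, hη, c, hsum, hcε⟩ := posSumOfEncodable (half_pos hε) ℕ
  choose K U hK hU hKA hAU hlK using fun n => hl (A n) (hA n) (η n) (hη n)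
  -- The intersection of all `K n` lies in that of the `A n`, so compactness empties a finite one.
  -- Later `A n` are then covered by the `A j \ K j` with `j ≤ N`.
  have hcov : ∃ N, ⋂ n < N + 1, K n = ∅ := by
    by_contra hcon
    push Not at hcon
    have := IsCompact.nonempty_iInter_of_sequence_nonempty_isCompact_isClosed
      (fun N => ⋂ n < N + 1, K n)
      (fun N => Set.biInter_subset_biInter_left fun n (hn : n < N + 1) => hn.trans (Nat.lt_succ_self _))
      hcon
      ((hK 0).of_isClosed_subset (isClosed_biInter fun n _ => (hK n).isClosed)
        (Set.iInter₂_subset 0 Nat.zero_lt_one))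
      (fun N => isClosed_biInter fun n _ => (hK n).isClosed)
    obtain ⟨z, hz⟩ := this
    have : z ∈ ⋂ n, A n := Set.mem_iInter.2 fun n =>
      hKA n (Set.mem_iInter₂.1 (Set.mem_iInter.1 hz n) n (Nat.lt_succ_self n))
    rw [hempty] at this
    exact this
  obtain ⟨N, hN⟩ := hcov
  refine ⟨N, fun n hn => ?_⟩
  rw [Real.dist_eq, sub_zero]
  have hb := abs_le_sum_of_subset_biUnion hadd (C := fun n => A n \ K n)
    (fun n => (hA n).diff (hK n).isClosed.measurableSet) (η := η)
    (fun n B hB hsub => hlK n B hB (hsub.trans (Set.sdiff_subset_sdiff_left (hAU n)))) (N + 1)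
    (A n) (hA n) (by
      intro z hz
      by_contra hcon
      simp only [Set.mem_iUnion, not_exists] at hcon
      have : z ∈ ⋂ n < N + 1, K n := Set.mem_iInter₂.2 fun j hj => by
        by_contra hzj
        exact hcon j hj ⟨hanti (by omega : j ≤ n) hz, hzj⟩
      rw [hN] at this
      exact this)
  calc |l (A n)| ≤ ∑ n ∈ Finset.range (N + 1), η n := hb
    _ ≤ c := sum_le_hasSum _ (fun i _ => (hη i).le) hsum
    _ ≤ ε / 2 := hcε
    _ < ε := half_lt_self hε

end ScalarRegular

/-! ### Tails of disjoint unions and countable additivity -/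

section Tails

variable {H : Type*} {s : ℕ → Set H}

lemma iUnion_add_eq_union (s : ℕ → Set H) (N : ℕ) :
    ⋃ i, s (N + i) = s N ∪ ⋃ i, s (N + 1 + i) := by
  ext z
  simp only [Set.mem_iUnion, Set.mem_union]
  constructor
  · rintro ⟨i, hi⟩
    cases i with
    | zero => exact Or.inl hi
    | succ i => exact Or.inr ⟨i, by rwa [add_right_comm, add_assoc]⟩
  · rintro (h | ⟨i, hi⟩)
    · exact ⟨0, h⟩
    · exact ⟨i + 1, by rwa [add_right_comm, add_assoc] at hi⟩

lemma disjoint_iUnion_add (hs : Pairwise (Function.onFun Disjoint s)) (N : ℕ) :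
    Disjoint (s N) (⋃ i, s (N + 1 + i)) :=
  Set.disjoint_iUnion_right.2 fun i => hs (by omega)

lemma antitone_iUnion_add (s : ℕ → Set H) : Antitone fun N => ⋃ i, s (N + i) :=
  antitone_nat_of_succ_le fun N => by
    rw [iUnion_add_eq_union s N]
    exact Set.subset_union_right

lemma iInter_iUnion_add (hs : Pairwise (Function.onFun Disjoint s)) :
    ⋂ N, ⋃ i, s (N + i) = ∅ := by
  refine Set.eq_empty_of_forall_notMem fun z hz => ?_
  obtain ⟨i, hi⟩ := Set.mem_iUnion.1 (Set.mem_iInter.1 hz 0)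
  obtain ⟨j, hj⟩ := Set.mem_iUnion.1 (Set.mem_iInter.1 hz (i + 1))
  exact Set.disjoint_left.1 (hs (by omega : 0 + i ≠ i + 1 + j)) hi hj

lemma sum_add_iUnion_add [MeasurableSpace H] {G : Type*} [AddCommGroup G] {m : Set H → G}
    (hadd : ∀ A B, MeasurableSet A → MeasurableSet B → Disjoint A B → m (A ∪ B) = m A + m B)
    (hm : ∀ n, MeasurableSet (s n)) (hs : Pairwise (Function.onFun Disjoint s)) (N : ℕ) :
    m (⋃ i, s i) = ∑ n ∈ Finset.range N, m (s n) + m (⋃ i, s (N + i)) := by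
  induction N with
  | zero => simp
  | succ N ih =>
    rw [ih, Finset.sum_range_succ, iUnion_add_eq_union s N,
      hadd _ _ (hm N) (MeasurableSet.iUnion fun i => hm _) (disjoint_iUnion_add hs N), add_assoc]

end Tails

/-- A set function of bounded variation that is additive and has a countably subadditive norm is a
vector measure. -/
theorem exists_vectorMeasure_of_isSigmaSubadditiveSetFun {H W : Type*} [MeasurableSpace H]
    [NormedAddCommGroup W] [CompleteSpace W] {m : Set H → W}
    (hadd : ∀ A B, MeasurableSet A → MeasurableSet B → Disjoint A B → m (A ∪ B) = m A + m B)
    (hsub : IsSigmaSubadditiveSetFun fun A => ‖m A‖ₑ) (hbv : setVariation m Set.univ ≠ ∞) :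
    ∃ M : NormedVectorMeasure H W, ∀ A, MeasurableSet A → M A = m A := by
  classical
  have hm0 : m ∅ = 0 := additive_empty hadd
  -- The variation dominates the norm of `m`: it bounds the series absolutely and sends the tails to
  -- 0.
  let μ : Measure H := preVariation (fun A => ‖m A‖ₑ) hsub (by simp [hm0])
  have hμ : ∀ A, MeasurableSet A → μ A = setVariation m A := fun A hA => by
    simp only [μ, preVariation_apply, VectorMeasure.ennrealToMeasure_apply hA,
      ennrealPreVariation_apply, setVariation]
  have hfin : IsFiniteMeasure μ := ⟨by rw [hμ _ MeasurableSet.univ]; exact hbv.lt_top⟩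
  have hle : ∀ A, MeasurableSet A → ‖m A‖ₑ ≤ μ A := by
    intro A hA
    by_cases hA' : (⟨A, hA⟩ : Subtype MeasurableSet) = ⊥
    · have : A = ∅ := congrArg Subtype.val hA'
      simp [this, hm0]
    rw [hμ A hA, setVariation]
    refine le_trans (le_of_eq ?_)
      (preVariation.sum_le (fun B => ‖m B‖ₑ) hA (Finpartition.indiscrete hA'))
    simp
  have hle' : ∀ A, MeasurableSet A → ‖m A‖ ≤ μ.real A := fun A hA => by
    rw [measureReal_def, ← toReal_enorm]
    exact ENNReal.toReal_mono (measure_ne_top _ _) (hle A hA)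
  refine ⟨{ measureOf' := fun A => if MeasurableSet A then m A else 0
            empty' := by simp [hm0]
            not_measurable' := fun A hA => if_neg hA
            m_iUnion' := fun s hs hdis => ?_ }, fun A hA => if_pos hA⟩
  simp only [hs, MeasurableSet.iUnion hs, if_true]
  have hsum : Summable fun i => m (s i) := by
    refine Summable.of_norm_bounded (g := fun i => μ.real (s i)) ?_ fun i => hle' _ (hs i)
    refine ENNReal.summable_toReal ?_
    rw [← measure_iUnion hdis hs]
    exact measure_ne_top _ _
  rw [hsum.hasSum_iff_tendsto_nat, tendsto_iff_norm_sub_tendsto_zero]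
  have hlim : Tendsto (fun N => μ (⋃ i, s (N + i))) atTop (𝓝 0) := by
    have := tendsto_measure_iInter_atTop (μ := μ) (s := fun N => ⋃ i, s (N + i))
      (fun N => (MeasurableSet.iUnion fun i => hs _).nullMeasurableSet)
      (antitone_iUnion_add s) ⟨0, measure_ne_top _ _⟩
    rwa [iInter_iUnion_add hdis, measure_empty] at this
  have hlim' := (ENNReal.tendsto_toReal ENNReal.zero_ne_top).comp hlim
  refine squeeze_zero (fun _ => norm_nonneg _) (fun N => ?_) hlim'
  rw [sum_add_iUnion_add hadd hs hdis N, sub_add_cancel_left, norm_neg]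
  exact hle' _ (MeasurableSet.iUnion fun i => hs _)

/-! ### Variation of a weakly regular set function -/

section WeaklyRegular

variable {H X Z : Type*} [TopologicalSpace H] [T2Space H] [MeasurableSpace H]
  [OpensMeasurableSpace H] [NormedAddCommGroup X] [NormedSpace ℝ X]
  [NormedAddCommGroup Z] [NormedSpace ℝ Z] {m : Set H → OpSpace X (StrongDual ℝ Z)}

lemma opNorm_le_of_forall_abs_apply_le {S : OpSpace X (StrongDual ℝ Z)} {c : ℝ} (hc : 0 ≤ c)
    (h : ∀ x z, |S x z| ≤ c * ‖x‖ * ‖z‖) : ‖S‖ ≤ c :=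
  ContinuousLinearMap.opNorm_le_bound _ hc fun x =>
    ContinuousLinearMap.opNorm_le_bound _ (by positivity) fun z => h x z

lemma abs_apply_le_norm (S : OpSpace X (StrongDual ℝ Z)) (x : X) (z : Z) :
    |S x z| ≤ ‖S‖ * ‖x‖ * ‖z‖ := S.le_opNorm₂ x z

/-- For fixed `x` and `z` the tail of the union vanishes by Alexandroff's theorem, and the bound on
the partial sums is uniform on the unit balls. -/
lemma isSigmaSubadditiveSetFun_of_weaklyRegular
    (hadd : ∀ A B, MeasurableSet A → MeasurableSet B → Disjoint A B → m (A ∪ B) = m A + m B)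
    (hreg : ∀ x z, IsRegularSetFun fun A => m A x z) :
    IsSigmaSubadditiveSetFun fun A => ‖m A‖ₑ := by
  intro s hs
  dsimp only
  rcases eq_or_ne (∑' i, ‖m (s i)‖ₑ) ⊤ with htop | htop
  · rw [htop]; exact le_top
  have hs' : Pairwise (Function.onFun Disjoint fun i => (s i).val) := hs
  rw [← ofReal_norm, ← ENNReal.ofReal_toReal htop]
  refine ENNReal.ofReal_le_ofReal (opNorm_le_of_forall_abs_apply_le ENNReal.toReal_nonneg
    fun x z => ?_)
  have hadd' : ∀ A B, MeasurableSet A → MeasurableSet B → Disjoint A B →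
      m (A ∪ B) x z = m A x z + m B x z := fun A B hA hB hAB => by rw [hadd A B hA hB hAB]; rfl
  have hlim := ((hreg x z).tendsto_zero hadd' (A := fun N => ⋃ i, (s (N + i)).val)
    (fun N => MeasurableSet.iUnion fun i => (s _).2)
    (antitone_iUnion_add fun i => (s i).val) (iInter_iUnion_add hs')).abs.const_add
      ((∑' i, ‖m (s i)‖ₑ).toReal * ‖x‖ * ‖z‖)
  rw [abs_zero, add_zero] at hlim
  refine ge_of_tendsto hlim (Eventually.of_forall fun N => ?_)
  rw [sum_add_iUnion_add (m := fun A => m A x z) hadd' (fun n => (s n).2) hs' N]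
  refine (abs_add_le _ _).trans (add_le_add ?_ le_rfl)
  calc |∑ n ∈ Finset.range N, m (s n) x z| ≤ ∑ n ∈ Finset.range N, |m (s n) x z| :=
        Finset.abs_sum_le_sum_abs _ _
    _ ≤ ∑ n ∈ Finset.range N, ‖m (s n)‖ * ‖x‖ * ‖z‖ :=
        Finset.sum_le_sum fun n _ => abs_apply_le_norm _ _ _
    _ = (∑ n ∈ Finset.range N, ‖m (s n)‖) * ‖x‖ * ‖z‖ := by simp_rw [Finset.sum_mul]
    _ ≤ (∑' i, ‖m (s i)‖ₑ).toReal * ‖x‖ * ‖z‖ := by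
        gcongr
        rw [← ENNReal.ofReal_le_iff_le_toReal htop, ENNReal.ofReal_sum_of_nonneg
          fun n _ => norm_nonneg (m (s n))]
        simp_rw [ofReal_norm]
        exact ENNReal.sum_le_tsum _

/-- The variation of a weakly regular vector measure is inner regular. -/
lemma innerRegularCompactLTTop_variation {M : NormedVectorMeasure H (OpSpace X (StrongDual ℝ Z))}
    (hreg : ∀ x z, IsRegularSetFun fun A => M A x z) :
    M.variation.InnerRegularCompactLTTop := by
  -- Regularity yields a `K` that depends on `x` and `z`. If all compact sets left a gap `δ` in
  -- norm, every scalar would inherit it, and `‖M A‖ ≤ ‖M A‖ - δ` would follow.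
  have hcomp : ∀ A, MeasurableSet A → ∀ δ : NNReal, 0 < δ →
      ∃ K ⊆ A, IsCompact K ∧ ‖M A‖ₑ ≤ ‖M K‖ₑ + δ := by
    intro A hA δ hδ
    by_contra hcon
    push Not at hcon
    have hlt : ∀ K ⊆ A, IsCompact K → ‖M K‖ + δ < ‖M A‖ := fun K hKA hK => by
      have := hcon K hKA hK
      simp only [enorm_eq_nnnorm] at this
      exact_mod_cast this
    have h0 : (δ : ℝ) < ‖M A‖ := by simpa using hlt ∅ (Set.empty_subset _) isCompact_empty
    have : ‖M A‖ ≤ ‖M A‖ - δ := by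
      refine opNorm_le_of_forall_abs_apply_le (by linarith) fun x z => ?_
      refine le_of_forall_pos_le_add fun ε hε => ?_
      obtain ⟨K, U, hK, -, hKA, hAU, hl⟩ := hreg x z A hA ε hε
      have e : M A x z = M K x z + M (A \ K) x z := by
        rw [← M.of_add_of_sdiff hK.isClosed.measurableSet hA hKA]; rfl
      rw [e]
      refine (abs_add_le _ _).trans (add_le_add ?_
        (hl _ (hA.diff hK.isClosed.measurableSet) (Set.sdiff_subset_sdiff_left hAU)))
      refine (abs_apply_le_norm _ _ _).trans ?_
      gcongr
      linarith [hlt K hKA hK]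
    have : (0 : ℝ) < δ := hδ
    linarith
  refine ⟨fun A hA r hr => ?_⟩
  obtain ⟨P, hPA, hPdis, hPm, hP⟩ := M.exists_lt_sum_of_lt_variation hA.1 hr
  obtain ⟨t, ht, htP⟩ := ENNReal.lt_iff_exists_add_pos_lt.1 hP
  -- The slack `t` is shared among the members of `P`; the `+ 1` guards against an empty `P`.
  have hex : ∀ B : Set H, ∃ K : Set H, B ∈ P →
      K ⊆ B ∧ IsCompact K ∧ ‖M B‖ₑ ≤ ‖M K‖ₑ + (t / (P.card + 1) : NNReal) := by
    intro B
    by_cases hB : B ∈ P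
    · obtain ⟨K, h⟩ := hcomp B (hPm B hB) (t / (P.card + 1)) (by positivity)
      exact ⟨K, fun _ => h⟩
    · exact ⟨∅, fun h => absurd h hB⟩
  choose K hK using hex
  refine ⟨⋃ B ∈ P, K B, Set.iUnion₂_subset fun B hB => (hK B hB).1.trans (hPA B hB),
    P.finite_toSet.isCompact_biUnion fun B hB => (hK B hB).2.1, ?_⟩
  have hsum : ∑ B ∈ P, ‖M B‖ₑ ≤ M.variation (⋃ B ∈ P, K B) + t := by
    calc ∑ B ∈ P, ‖M B‖ₑ
        ≤ ∑ B ∈ P, (M.variation (K B) + (t / (P.card + 1) : NNReal)) :=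
          Finset.sum_le_sum fun B hB => (hK B hB).2.2.trans
            (add_le_add (M.enorm_measure_le_variation _) le_rfl)
      _ = M.variation (⋃ B ∈ P, K B) + (P.card * (t / (P.card + 1)) : NNReal) := by
          rw [Finset.sum_add_distrib, measure_biUnion_finset
            (fun B hB C hC hBC => (hPdis hB hC hBC).mono (hK B hB).1 (hK C hC).1)
            fun B hB => (hK B hB).2.1.isClosed.measurableSet]
          simp
      _ ≤ M.variation (⋃ B ∈ P, K B) + t := by
          gcongr
          rw [mul_div_assoc', div_le_iff₀ (by positivity)]
          rw [mul_comm]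
          gcongr
          simp
  have := htP.trans_le hsum
  exact (ENNReal.add_lt_add_iff_right ENNReal.coe_ne_top).1 this

end WeaklyRegular

/-! ### Transfer of vector measures along isometries -/

section Variation

variable {H V W : Type*} [MeasurableSpace H] [NormedAddCommGroup V] [NormedAddCommGroup W]

lemma variation_apply_eq_setVariation {M : NormedVectorMeasure H V} {m : Set H → W}
    (h : ∀ A, MeasurableSet A → ‖M A‖ = ‖m A‖) {A : Set H} (hA : MeasurableSet A) :
    M.variation A = setVariation m A := by
  rw [VectorMeasure.variation_apply, preVariation_apply, VectorMeasure.ennrealToMeasure_apply hA,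
    ennrealPreVariation_apply, setVariation, preVariationFun_apply _ hA, preVariationFun_apply _ hA]
  refine iSup_congr fun P => Finset.sum_congr rfl fun B _ => ?_
  rw [← ofReal_norm, ← ofReal_norm, h B B.2]

lemma variation_eq_of_norm_eq {M : NormedVectorMeasure H V} {M' : NormedVectorMeasure H W}
    (h : ∀ A, MeasurableSet A → ‖M A‖ = ‖M' A‖) : M.variation = M'.variation :=
  Measure.ext fun A hA => by
    rw [variation_apply_eq_setVariation h hA]
    exact (variation_apply_eq_setVariation (fun _ _ => rfl) hA).symm

/-- A vector measure with values in the range of a linear isometry comes from a vector measure with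
values in its domain. -/
lemma exists_vectorMeasure_comp_eq [NormedSpace ℝ V] [NormedSpace ℝ W] (J : V →ₗᵢ[ℝ] W)
    {M : NormedVectorMeasure H W} (hM : ∀ A, M A ∈ Set.range J) :
    ∃ M₀ : NormedVectorMeasure H V, ∀ A, J (M₀ A) = M A := by
  choose c hc using hM
  refine ⟨{ measureOf' := c
            empty' := J.injective (by rw [hc, map_zero, M.empty])
            not_measurable' := fun A hA => J.injective (by rw [hc, map_zero, M.not_measurable hA])
            m_iUnion' := fun s hs hdis => ?_ }, hc⟩
  rw [← J.isometry.isUniformInducing.isInducing.hasSum_iff]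
  simpa only [Function.comp_def, hc] using M.m_iUnion hs hdis

lemma norm_sub_le_of_tendsto {a : ℕ → W} {b w : W} {c : ℕ → ℝ} {d : ℝ}
    (ha : Tendsto a atTop (𝓝 b)) (hc : Tendsto c atTop (𝓝 d)) (h : ∀ n, ‖a n - w‖ ≤ c n) :
    ‖b - w‖ ≤ d :=
  le_of_tendsto_of_tendsto' (ha.sub_const w).norm hc h

lemma exists_vectorMeasure_postcomp_eq {X : Type*} [NormedAddCommGroup X] [NormedSpace ℝ X]
    [NormedSpace ℝ V] [NormedSpace ℝ W] (J : V →ₗᵢ[ℝ] W) {M : NormedVectorMeasure H (OpSpace X W)}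
    (hM : ∀ A, MeasurableSet A → ∀ x, M A x ∈ Set.range J) :
    ∃ M₀ : NormedVectorMeasure H (OpSpace X V), (∀ A x, J (M₀ A x) = M A x) ∧
      ∀ A, ‖M₀ A‖ = ‖M A‖ := by
  have hrange : ∀ A, M A ∈ Set.range (J.postcomp : OpSpace X V →ₗᵢ[ℝ] OpSpace X W) := by
    intro A
    by_cases hA : MeasurableSet A
    · let e := J.equivRange
      refine ⟨e.symm.toContinuousLinearEquiv.toContinuousLinearMap.comp
        ((M A).codRestrict (LinearMap.range J.toLinearMap) (hM A hA)), ?_⟩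
      ext1 x
      exact congrArg Subtype.val (e.apply_symm_apply ⟨M A x, hM A hA x⟩)
    · exact ⟨0, by rw [map_zero, M.not_measurable hA]⟩
  obtain ⟨M₀, hM₀⟩ := exists_vectorMeasure_comp_eq _ hrange
  exact ⟨M₀, fun A x => by rw [← hM₀ A]; rfl, fun A => by rw [← hM₀ A, LinearIsometry.norm_map]⟩

lemma LinearIsometry.mem_range_of_forall_exists_norm_sub_lt [NormedSpace ℝ V] [NormedSpace ℝ W]
    [CompleteSpace V] (J : V →ₗᵢ[ℝ] W) {w : W} (h : ∀ ε > 0, ∃ v, ‖J v - w‖ < ε) :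
    w ∈ Set.range J := by
  rw [← J.isometry.isClosedEmbedding.isClosed_range.closure_eq, Metric.mem_closure_iff]
  intro ε hε
  obtain ⟨v, hv⟩ := h ε hε
  exact ⟨J v, ⟨v, rfl⟩, by rwa [dist_comm, dist_eq_norm]⟩

end Variation

/-! ### The values lie in `Y` -/

section Values

variable {H X Z : Type*} [MeasurableSpace H] [NormedAddCommGroup X] [NormedSpace ℝ X]
  [NormedAddCommGroup Z] [NormedSpace ℝ Z]

/-- Approximation of `g • x` by simple functions, uniformly up to `‖x‖ / (n + 1)`. -/
lemma exists_simpleFunc_norm_sub_smul_le {g : H → ℝ} (hg : Measurable g)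
    (h01 : ∀ z, g z ∈ Set.Icc (0 : ℝ) 1) (x : X) (n : ℕ) :
    ∃ s : SimpleFunc H X, ∀ z, ‖s z - g z • x‖ ≤ 1 / ((n : ℝ) + 1) * ‖x‖ := by
  have hn : (0 : ℝ) < (n : ℝ) + 1 := by positivity
  have hm : Measurable fun z => ⌊((n : ℝ) + 1) * g z⌋₊ := Nat.measurable_floor.comp (hg.const_mul _)
  let k : SimpleFunc H ℕ :=
    { toFun := fun z => ⌊((n : ℝ) + 1) * g z⌋₊
      measurableSet_fiber' := fun c => hm (measurableSet_singleton c)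
      finite_range' := (Set.finite_Iic (n + 1)).subset (by
        rintro _ ⟨z, rfl⟩
        refine Set.mem_Iic.2 (Nat.floor_le_of_le ?_)
        push_cast
        nlinarith [(h01 z).2]) }
  refine ⟨k.map fun j : ℕ => ((j : ℝ) / ((n : ℝ) + 1)) • x, fun z => ?_⟩
  rw [SimpleFunc.map_apply, ← sub_smul, norm_smul]
  gcongr
  have hk : (k z : ℝ) = ⌊((n : ℝ) + 1) * g z⌋₊ := rfl
  have h1 : (k z : ℝ) ≤ ((n : ℝ) + 1) * g z :=
    hk ▸ Nat.floor_le (mul_nonneg hn.le (h01 z).1)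
  have h2 : ((n : ℝ) + 1) * g z < k z + 1 := hk ▸ Nat.lt_floor_add_one _
  have e : (k z : ℝ) / ((n : ℝ) + 1) - g z = (k z - ((n : ℝ) + 1) * g z) / ((n : ℝ) + 1) := by
    field_simp
  rw [e, Real.norm_eq_abs, abs_div, abs_of_pos hn]
  gcongr
  rw [abs_le]
  constructor <;> linarith

lemma norm_setToSimpleFunc_sub_le {μ : Measure H} [IsFiniteMeasure μ] {m : Set H → OpSpace X Z}
    (hadd : ∀ A B, MeasurableSet A → MeasurableSet B → Disjoint A B → m (A ∪ B) = m A + m B)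
    (hle : ∀ A, MeasurableSet A → ‖m A‖ ≤ μ.real A) {A : Set H} (hA : MeasurableSet A) (x : X)
    (s : SimpleFunc H X) {k : H → ℝ} (hk : Integrable k μ)
    (hs : ∀ z, ‖s z - A.indicator (fun _ => x) z‖ ≤ k z) :
    ‖s.setToSimpleFunc m - m A x‖ ≤ ∫ z, k z ∂μ := by
  classical
  have hm0 : m ∅ = 0 := additive_empty hadd
  set a : SimpleFunc H X := SimpleFunc.piecewise A hA (SimpleFunc.const H x) (SimpleFunc.const H 0)
  have hfm : FinMeasAdditive μ m := fun A B hA hB _ _ hAB => hadd A B hA hB hAB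
  have hsi : Integrable s μ := s.integrable_of_isFiniteMeasure
  have hai : Integrable a μ := a.integrable_of_isFiniteMeasure
  rw [← SimpleFunc.setToSimpleFunc_indicator m hm0 hA x, ← SimpleFunc.setToSimpleFunc_sub m hfm hsi hai]
  have hi : Integrable (s - a) μ := (s - a).integrable_of_isFiniteMeasure
  refine (SimpleFunc.norm_setToSimpleFunc_le_integral_norm m (C := 1)
    (fun B hB _ => (hle B hB).trans (one_mul _).ge) hi).trans ?_
  rw [one_mul, SimpleFunc.integral_eq_integral _ (((s - a).map norm).integrable_of_isFiniteMeasure)]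
  refine integral_mono (((s - a).map norm).integrable_of_isFiniteMeasure) hk fun z => ?_
  rw [SimpleFunc.map_apply]
  refine le_trans (le_of_eq ?_) (hs z)
  congr 1

variable [TopologicalSpace H] [CompactSpace H] [T2Space H] [BorelSpace H]
  {Y : Type*} [NormedAddCommGroup Y] [NormedSpace ℝ Y]

/-- The representing set function of an operator with values in `Y` has values in `Y` if it is
dominated by a finite Radon measure. -/
lemma Represents.mem_range [CompleteSpace Y] {μ : Measure H} [IsFiniteMeasure μ]
    [μ.InnerRegularCompactLTTop] {T : C(H, X) →L[ℝ] Y}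
    {m : Set H → OpSpace X (StrongDual ℝ (StrongDual ℝ Y))} (hmT : Represents m T)
    (hle : ∀ A, MeasurableSet A → ‖m A‖ ≤ μ.real A) {A : Set H} (hA : MeasurableSet A) (x : X) :
    m A x ∈ Set.range (NormedSpace.inclusionInDoubleDualLi ℝ (E := Y)) := by
  refine LinearIsometry.mem_range_of_forall_exists_norm_sub_lt
    (V := Y) (W := StrongDual ℝ (StrongDual ℝ Y))
    (NormedSpace.inclusionInDoubleDualLi ℝ (E := Y)) fun ε hε => ?_
  obtain ⟨r, hr, hrε⟩ : ∃ r : ℝ, 0 < r ∧ 2 * r * ‖x‖ < ε := by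
    refine ⟨ε / (2 * (‖x‖ + 1)), by positivity, ?_⟩
    rw [mul_div_assoc', div_mul_eq_mul_div, div_lt_iff₀ (by positivity)]
    nlinarith [norm_nonneg x]
  have hr' : ENNReal.ofReal r ≠ 0 := (ENNReal.ofReal_pos.2 hr).ne'
  -- A Urysohn function `g`, 1 on `K ⊆ A` and 0 on `L ⊆ Aᶜ`, has `g • x` differ from the indicator
  -- of `A` times `x` only on `N`, of measure at most `2 * r`, and there by at most `‖x‖`.
  obtain ⟨K, hKA, hK, hKμ⟩ := hA.exists_isCompact_sdiff_lt (measure_ne_top μ A) hr'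
  obtain ⟨L, hLA, hL, hLμ⟩ := hA.compl.exists_isCompact_sdiff_lt (measure_ne_top μ Aᶜ) hr'
  obtain ⟨g, hgL, hgK, hg01⟩ := exists_continuous_zero_one_of_isClosed hL.isClosed hK.isClosed
    (Set.disjoint_left.2 fun z h1 h2 => hLA h1 (hKA h2))
  set N := (A \ K) ∪ (Aᶜ \ L)
  have hNm : MeasurableSet N :=
    (hA.diff hK.isClosed.measurableSet).union (hA.compl.diff hL.isClosed.measurableSet)
  have hNμ : μ.real N ≤ 2 * r := by
    refine (measureReal_union_le _ _).trans ?_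
    have h1 : μ.real (A \ K) ≤ r := ENNReal.toReal_le_of_le_ofReal hr.le hKμ.le
    have h2 : μ.real (Aᶜ \ L) ≤ r := ENNReal.toReal_le_of_le_ofReal hr.le hLμ.le
    linarith
  have hgA : ∀ z, ‖g z • x - A.indicator (fun _ => x) z‖ ≤ N.indicator (fun _ => ‖x‖) z := by
    intro z
    have hg := hg01 z
    by_cases hzA : z ∈ A
    · rw [Set.indicator_of_mem hzA]
      by_cases hzK : z ∈ K
      · have : g z = 1 := hgK hzK
        rw [this, one_smul, sub_self, norm_zero]
        exact Set.indicator_nonneg (fun _ _ => norm_nonneg x) z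
      · rw [Set.indicator_of_mem (show z ∈ N from Or.inl ⟨hzA, hzK⟩)]
        have e : g z • x - x = (g z - 1) • x := by rw [sub_smul, one_smul]
        rw [e, norm_smul, Real.norm_eq_abs]
        refine mul_le_of_le_one_left (norm_nonneg x) (abs_le.2 ⟨?_, ?_⟩) <;> linarith [hg.1, hg.2]
    · rw [Set.indicator_of_notMem hzA, sub_zero, norm_smul, Real.norm_eq_abs]
      by_cases hzL : z ∈ L
      · have : g z = 0 := hgL hzL
        rw [this, abs_zero, zero_mul]
        exact Set.indicator_nonneg (fun _ _ => norm_nonneg x) z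
      · rw [Set.indicator_of_mem (show z ∈ N from Or.inr ⟨hzA, hzL⟩)]
        refine mul_le_of_le_one_left (norm_nonneg x) (abs_le.2 ⟨?_, ?_⟩) <;> linarith [hg.1, hg.2]
  choose s hs using fun n => exists_simpleFunc_norm_sub_smul_le g.continuous.measurable hg01 x n
  let G : C(H, X) := ⟨fun z => g z • x, by fun_prop⟩
  have hunif : TendstoUniformly (fun n z => s n z) G atTop := by
    rw [Metric.tendstoUniformly_iff]
    intro ε hε
    have := (tendsto_one_div_add_atTop_nhds_zero_nat (𝕜 := ℝ)).mul_const ‖x‖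
    rw [zero_mul] at this
    filter_upwards [this.eventually (gt_mem_nhds hε)] with n hn z
    rw [dist_comm, dist_eq_norm]
    exact (hs n z).trans_lt hn
  have hlim := hmT.integral_eq G s hunif
  refine ⟨T G, ?_⟩
  refine lt_of_le_of_lt ?_ hrε
  have hbound : ∀ n, ‖(s n).setToSimpleFunc m - m A x‖ ≤
      1 / ((n : ℝ) + 1) * ‖x‖ * μ.real Set.univ + 2 * r * ‖x‖ := by
    intro n
    have hint : Integrable (N.indicator fun _ => ‖x‖) μ := (integrable_const _).indicator hNm
    refine (norm_setToSimpleFunc_sub_le hmT.additive hle hA x (s n)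
      (k := fun z => 1 / ((n : ℝ) + 1) * ‖x‖ + N.indicator (fun _ => ‖x‖) z)
      ((integrable_const _).add hint) fun z => ?_).trans ?_
    · exact (norm_sub_le_norm_sub_add_norm_sub _ (g z • x) _).trans (add_le_add (hs n z) (hgA z))
    · rw [integral_add (integrable_const _) hint, integral_const, integral_indicator hNm,
        setIntegral_const, smul_eq_mul, smul_eq_mul, mul_comm (μ.real Set.univ)]
      gcongr
  have hl2 : Tendsto (fun n : ℕ => 1 / ((n : ℝ) + 1) * ‖x‖ * μ.real Set.univ + 2 * r * ‖x‖) atTop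
      (𝓝 (2 * r * ‖x‖)) := by
    have := (((tendsto_one_div_add_atTop_nhds_zero_nat (𝕜 := ℝ)).mul_const ‖x‖).mul_const
      (μ.real Set.univ)).add_const (2 * r * ‖x‖)
    simpa using this
  exact norm_sub_le_of_tendsto (W := StrongDual ℝ (StrongDual ℝ Y)) hlim hl2 hbound

end Values

/-! ### The main theorem -/

theorem proposition8
    {H : Type u} [TopologicalSpace H] [CompactSpace H] [T2Space H]
    [MeasurableSpace H] [BorelSpace H]
    {X : Type v} [NormedAddCommGroup X] [NormedSpace ℝ X] [CompleteSpace X]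
    {Y : Type w} [NormedAddCommGroup Y] [NormedSpace ℝ Y] [CompleteSpace Y]
    (hL : WeakRadonNikodymProperty.{u, max v w} (OpSpace X Y))
    (T : C(H, X) →L[ℝ] Y) (m : Set H → OpSpace X (StrongDual ℝ (StrongDual ℝ Y)))
    (hmT : Represents m T) (hbv : setVariation m Set.univ ≠ ∞) :
    -- `m` is, up to the embedding of `Y` in `Y**`, a vector measure with values in `L(X, Y)`
    ∃ m₀ : NormedVectorMeasure H (OpSpace X Y),
      (∀ A, MeasurableSet A → ∀ x, m A x = NormedSpace.inclusionInDoubleDual ℝ Y (m₀ A x)) ∧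
      (∀ A, MeasurableSet A → m₀.variation A = setVariation m A) ∧
      -- it has a Pettis integrable derivative with respect to `|m|`
      (∃ f : H → OpSpace X Y, IsPettisDensity m₀ m₀.variation f) ∧
      -- and the partition averages converge in Pettis norm to each such derivative
      ∀ f : H → OpSpace X Y, IsPettisDensity m₀ m₀.variation f →
        Tendsto (fun π : MeasPartition H =>
            pettisNorm (fun h => partitionAverage m₀ m₀.variation π h - f h) m₀.variation)
          atBot (𝓝 0) := by
  obtain ⟨M, hM⟩ := exists_vectorMeasure_of_isSigmaSubadditiveSetFun hmT.additive
    (isSigmaSubadditiveSetFun_of_weaklyRegular hmT.additive hmT.weaklyRegular) hbv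
  have hMvar : ∀ A, MeasurableSet A → M.variation A = setVariation m A := fun A hA =>
    variation_apply_eq_setVariation (fun B hB => by rw [hM B hB]) hA
  have hfin : IsFiniteMeasure M.variation :=
    ⟨by rw [hMvar _ MeasurableSet.univ]; exact hbv.lt_top⟩
  have hreg : M.variation.InnerRegularCompactLTTop := by
    refine innerRegularCompactLTTop_variation fun x y' A hA ε hε => ?_
    obtain ⟨K, U, hK, hU, hKA, hAU, h⟩ := hmT.weaklyRegular x y' A hA ε hε
    exact ⟨K, U, hK, hU, hKA, hAU, fun B hB hBU => by
      have := h B hB hBU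
      dsimp only at this ⊢
      rwa [hM B hB]⟩
  obtain ⟨m₀, hm₀, hnorm⟩ := exists_vectorMeasure_postcomp_eq
    (V := Y) (W := StrongDual ℝ (StrongDual ℝ Y)) (NormedSpace.inclusionInDoubleDualLi ℝ (E := Y))
    (M := M) fun A hA x => by
      rw [hM A hA]
      exact hmT.mem_range (μ := M.variation)
        (fun B hB => by rw [← hM B hB]; exact VectorMeasure.norm_measure_le_variation) hA x
  have hvar : m₀.variation = M.variation := variation_eq_of_norm_eq fun A _ => hnorm A
  have hfin₀ : IsFiniteMeasure m₀.variation := hvar ▸ hfin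
  have hreg₀ : m₀.variation.InnerRegularCompactLTTop := hvar ▸ hreg
  refine ⟨m₀, fun A hA x => ?_, fun A hA => by rw [hvar, hMvar A hA], ?_, fun f hf => ?_⟩
  · rw [← hM A hA, ← hm₀ A x]
    rfl
  · refine hL H m₀.variation m₀ (measure_ne_top _ _) fun A hA h0 => ?_
    exact (VectorMeasure.variation_apply_eq_zero hA).1 h0 A subset_rfl hA
  · exact tendsto_pettisNorm_partitionAverage_sub
      (fun A _ => VectorMeasure.norm_measure_le_variation) hf
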